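/- **Setting.** Let $H,U$ be real Hilbert spaces, $T>0$, $A$ a densely defined linear operator generating a strongly continuous semigroup $S(t)=e^{tA}$ on $H$, and $y_0\in H$. Let $f:[0,T]\times H\to\mathcal L(U,H)$ be such that $f(\cdot,y)$ is continuous on $[0,T]$ in operator norm for every $y$, $f(t,\cdot)$ is continuously Fréchet differentiable for every $t$, and $f$ is locally Lipschitz in $y$, locally uniformly in $t$. Let $l_1,m:H\to\mathbb R$ be continuously Fréchet differentiable, and let $R\in\mathcal L(U)$ be self-adjoint with $\langle Ru,u\rangle_U\ge\gamma_R\|u\|_U^2$ for all $u \in U$ and some $\gamma_R>0$. For a control $u$ with a unique mild state $y\in C([0,T];H)$, i.e. $y(t)=e^{tA}y_0+\int_0^te^{(t-s)A}f(s,y(s))u(s)\,ds$ for $t\in[0,T]$, put $J_1(u)=\int_0^Tl_1(y(s))\,ds+m(y(T))$. Let $u_1\in C([0,T];U)$, let $y\in C([0,T];H)$ be a mild state for $u_1$, and let $p\in C([0,T];H^*)$ be a corresponding mild solution of the adjoint problem, $$p(t)=e^{(T-t)A^*}m_y(y(T))+\int_t^Te^{(s-t)A^*}\Big(\big((f(s,y(s))u_1(s))_y\big)^*p(s)+(l_1)_y(y(s))\Big)ds,\qquad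 t\in[0,T].$$ For $\tau\in(0,T)$ and $v\in U$ let $u_{\lambda,\tau,v}$ equal $v$ on $[\tau-\frac\lambda2,\tau+\frac\lambda2]$ and $u_1$ elsewhere, and let $$\frac{dJ_1}{d\lambda^+}(\tau,v)=\lim_{\lambda\downarrow0}\frac{J_1(u_{\lambda,\tau,v})-J_1(u_1)}{\lambda}$$ be the mode insertion gradient. For $\alpha_d<0$, the SAC control $u^*(\tau)$ is the minimizer over $v\in U$ of $$\tfrac12\Big[\frac{dJ_1}{d\lambda^+}(\tau,v)-\alpha_d\Big]^2+\tfrac12\langle v,Rv\rangle_U .$$ Put $P(t)=f(t,y(t))^*p(t)\in U^*$ and $\Pi(t)=(P^*(t)P(t)+R^*)^{-1}$. **Proposition 2.2.** 1. If $P(t)\ne0$ for all $t\in[0,T]$, then there exists $\alpha_d<0$ such that for all $\tau\in(0,T)$ $$\frac{dJ_1}{d\lambda^+}(\tau,u^*(\tau))<0 .$$ 2. If $u_1\equiv0$ on $[0,T]$, the same holds if only $P(t)\ne0$ for all $t\in(0,T)$. 3. For every single $\tau\in(0,T)$ with $P(\tau)\neq0$ there exists $\alpha_d<0$ (which may depend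 on $\tau$) with $\frac{dJ_1}{d\lambda^+}(\tau,u^*(\tau))<0$. In each case, for these $\alpha_d$ and $\tau$, the states of $u_1$ and, for every $v \in U$ and all sufficiently small $\lambda>0$, of $u_{\lambda,\tau,v}$ exist uniquely, the mode insertion gradient $\frac{dJ_1}{d\lambda^+}(\tau,v)$ exists for every $v\in U$, and the minimizer $u^*(\tau)$ exists, is unique, and is given by the explicit formula $u^*(\tau)=\Pi(\tau)\big[P^*(\tau)P(\tau)u_1(\tau)+P^*(\tau)\alpha_d\big]$. -/

import Mathlib

open Filter Topology Set MeasureTheory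

/-- `S` (restricted to `t ≥ 0`) is a strongly continuous semigroup of bounded operators on `H`. -/
structure IsC0Semigroup {H : Type*} [NormedAddCommGroup H] [NormedSpace ℝ H]
    (S : ℝ → H →L[ℝ] H) : Prop where
  zero : S 0 = ContinuousLinearMap.id ℝ H
  add : ∀ s t : ℝ, 0 ≤ s → 0 ≤ t → S (s + t) = (S s).comp (S t)
  continuousOn : ∀ x : H, ContinuousOn (fun t => S t x) (Ici 0)

/-- The unbounded operator `A` is the infinitesimal generator of `S`: `x ∈ D(A)` and `A x = z`
if and only if `(S h x - x) / h → z` as `h ↓ 0`. -/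
def IsGenerator {H : Type*} [NormedAddCommGroup H] [NormedSpace ℝ H]
    (A : H →ₗ.[ℝ] H) (S : ℝ → H →L[ℝ] H) : Prop :=
  ∀ x z : H, (x, z) ∈ A.graph ↔
    Tendsto (fun h : ℝ => h⁻¹ • (S h x - x)) (𝓝[>] 0) (𝓝 z)

/-- Data and standing assumptions of the stage problem
`min ∫₀ᵀ l₁(y(s)) ds + m(y(T))` subject to `y' = A y + f(t, y) u`, `y(0) = y₀`,
together with the regularization operator `R` of the SAC subproblem. -/
structure StageProblem (H U : Type*) [NormedAddCommGroup H] [InnerProductSpace ℝ H]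
    [CompleteSpace H] [NormedAddCommGroup U] [InnerProductSpace ℝ U] [CompleteSpace U] where
  /-- time horizon -/
  T : ℝ
  T_pos : 0 < T
  /-- (possibly unbounded) system operator -/
  A : H →ₗ.[ℝ] H
  dense_domain : Dense (A.domain : Set H)
  /-- the semigroup `S t = e^{tA}` -/
  S : ℝ → H →L[ℝ] H
  isC0Semigroup : IsC0Semigroup S
  isGenerator : IsGenerator A S
  /-- control operator `f(t, y)`; only its values for `t ∈ [0, T]` matter -/
  f : ℝ → H → U →L[ℝ] H
  f_continuousOn : ∀ y : H, ContinuousOn (fun t => f t y) (Icc 0 T)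
  f_contDiff : ∀ t ∈ Icc 0 T, ContDiff ℝ 1 (f t)
  /-- `f` is locally Lipschitz in the state, locally uniformly in time. -/
  f_locallyLipschitz : ∀ t ∈ Icc 0 T, ∀ y : H, ∃ ε > 0, ∃ L : ℝ, ∀ s ∈ Icc 0 T, |s - t| < ε →
    ∀ z ∈ Metric.ball y ε, ∀ w ∈ Metric.ball y ε, ‖f s z - f s w‖ ≤ L * ‖z - w‖
  /-- initial state -/
  y₀ : H
  /-- running cost -/
  l₁ : H → ℝ
  l₁_contDiff : ContDiff ℝ 1 l₁
  /-- terminal cost -/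
  m : H → ℝ
  m_contDiff : ContDiff ℝ 1 m
  /-- regularization operator -/
  R : U →L[ℝ] U
  R_selfAdjoint : IsSelfAdjoint R
  R_coercive : ∃ γ > 0, ∀ u : U, γ * ‖u‖ ^ 2 ≤ inner ℝ (R u) u

namespace StageProblem

variable {H U : Type*} [NormedAddCommGroup H] [InnerProductSpace ℝ H] [CompleteSpace H]
  [NormedAddCommGroup U] [InnerProductSpace ℝ U] [CompleteSpace U]

/-- `y ∈ C([0,T]; H)` is a mild solution of the state equation for the control `u`. -/
def IsMildState (D : StageProblem H U) (u : ℝ → U) (y : ℝ → H) : Prop :=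
  ContinuousOn y (Icc 0 D.T) ∧ ∀ t ∈ Icc 0 D.T,
    IntervalIntegrable (fun s => D.S (t - s) (D.f s (y s) (u s))) volume 0 t ∧
    y t = D.S t D.y₀ + ∫ s in (0 : ℝ)..t, D.S (t - s) (D.f s (y s) (u s))

/-- `p ∈ C([0,T]; H*)` is a mild solution of the adjoint equation along the control `u` and the
state `y`. Adjoints act on the topological dual by precomposition, so that
`e^{rA*} φ = φ ∘ S r` and `((f(s, y) u)_y)* φ = φ ∘ (f(s, y) u)_y`. -/
def IsMildAdjoint (D : StageProblem H U) (u : ℝ → U) (y : ℝ → H) (p : ℝ → StrongDual ℝ H) :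
    Prop :=
  ContinuousOn p (Icc 0 D.T) ∧ ∀ t ∈ Icc 0 D.T,
    IntervalIntegrable (fun s =>
      ((p s).comp (fderiv ℝ (fun z => D.f s z (u s)) (y s)) + fderiv ℝ D.l₁ (y s)).comp
        (D.S (s - t))) volume t D.T ∧
    p t = (fderiv ℝ D.m (y D.T)).comp (D.S (D.T - t)) +
      ∫ s in t..D.T,
        ((p s).comp (fderiv ℝ (fun z => D.f s z (u s)) (y s)) + fderiv ℝ D.l₁ (y s)).comp
          (D.S (s - t))

/-- The control `u` has exactly one mild state on `[0, T]`. -/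
def HasUniqueState (D : StageProblem H U) (u : ℝ → U) : Prop :=
  ∃ y, D.IsMildState u y ∧ ∀ y', D.IsMildState u y' → EqOn y' y (Icc 0 D.T)

/-- Cost of a state trajectory. -/
noncomputable def trajectoryCost (D : StageProblem H U) (y : ℝ → H) : ℝ :=
  (∫ s in (0 : ℝ)..D.T, D.l₁ (y s)) + D.m (y D.T)

open Classical in
/-- The cost `J₁(u)`, evaluated along the mild state of `u`. It is used below only for controls
with `HasUniqueState`; the value `0` is a dummy for controls without a mild state. -/
noncomputable def J₁ (D : StageProblem H U) (u : ℝ → U) : ℝ :=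
  if h : ∃ y, D.IsMildState u y then D.trajectoryCost h.choose else 0

/-- The needle variation of `u₁` with value `v` on `[τ - r/2, τ + r/2]`. -/
noncomputable def needle (u₁ : ℝ → U) (r τ : ℝ) (v : U) : ℝ → U :=
  open Classical in fun t => if t ∈ Icc (τ - r / 2) (τ + r / 2) then v else u₁ t

/-- The mode insertion gradient `dJ₁/dλ⁺(τ, v)` with respect to the reference control `u₁` exists
and equals `g`: the costs involved are well defined (for small needles), and
`(J₁(u_{r,τ,v}) - J₁(u₁)) / r → g` as `r ↓ 0`. -/
def HasModeInsertionGradient (D : StageProblem H U) (u₁ : ℝ → U) (τ : ℝ) (v : U) (g : ℝ) : Prop :=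
  D.HasUniqueState u₁ ∧
  (∀ᶠ r in 𝓝[>] (0 : ℝ), D.HasUniqueState (needle u₁ r τ v)) ∧
  Tendsto (fun r : ℝ => (D.J₁ (needle u₁ r τ v) - D.J₁ u₁) / r) (𝓝[>] 0) (𝓝 g)

/-- `v` is a control value given by the SAC principle at time `τ` with parameter `α`: all mode
insertion gradients `G w = dJ₁/dλ⁺(τ, w)` exist, and `v` minimizes
`½ (G w - α)² + ½ ⟨w, R w⟩` over all `w ∈ U`. -/
def IsSACControl (D : StageProblem H U) (u₁ : ℝ → U) (α τ : ℝ) (v : U) : Prop :=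
  ∃ G : U → ℝ, (∀ w, D.HasModeInsertionGradient u₁ τ w (G w)) ∧
    ∀ w, (1 / 2) * (G v - α) ^ 2 + (1 / 2) * inner ℝ v (D.R v) ≤
      (1 / 2) * (G w - α) ^ 2 + (1 / 2) * inner ℝ w (D.R w)

/-- The functional `P(t) = f(t, y(t))* p(t) ∈ U*`. -/
def P (D : StageProblem H U) (y : ℝ → H) (p : ℝ → StrongDual ℝ H) (t : ℝ) : U →L[ℝ] ℝ :=
  (p t).comp (D.f t (y t))

/-- The operator `Π(t) = (P*(t) P(t) + R*)⁻¹`. -/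
noncomputable def Pi (D : StageProblem H U) (y : ℝ → H) (p : ℝ → StrongDual ℝ H) (t : ℝ) :
    U →L[ℝ] U :=
  ((ContinuousLinearMap.adjoint (D.P y p t)).comp (D.P y p t) +
    ContinuousLinearMap.adjoint D.R).inverse

/-- The explicit control `Π(τ) [P*(τ) P(τ) u₁(τ) + P*(τ) α]`. -/
noncomputable def sacControl (D : StageProblem H U) (u₁ : ℝ → U) (y : ℝ → H)
    (p : ℝ → StrongDual ℝ H) (α τ : ℝ) : U :=
  D.Pi y p τ (ContinuousLinearMap.adjoint (D.P y p τ) (D.P y p τ (u₁ τ)) +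
    ContinuousLinearMap.adjoint (D.P y p τ) α)

/-- The SAC control with parameter `α` is a descent control at time `τ`: the SAC subproblem has
exactly one solution `u*(τ)`, namely the explicit one, and the mode insertion gradient
`dJ₁/dλ⁺(τ, u*(τ))` exists and is negative. -/
def SACDescent (D : StageProblem H U) (u₁ : ℝ → U) (y : ℝ → H) (p : ℝ → StrongDual ℝ H)
    (α τ : ℝ) : Prop :=
  (∀ v : U, D.IsSACControl u₁ α τ v ↔ v = D.sacControl u₁ y p α τ) ∧
  ∃ g < 0, D.HasModeInsertionGradient u₁ τ (D.sacControl u₁ y p α τ) g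

end StageProblem

/-! The mode insertion gradient is affine in the inserted value: it equals `P(τ) (v - u₁(τ))`. The
SAC subproblem is therefore a regularized linear least squares problem, and the proposition reduces
to an estimate on its solution.

Gradient formula. A needle of length `r` changes the state by some `z`, which solves a Volterra
equation with the semigroup as kernel. Contraction and Grönwall give `z` with `‖z‖ ≤ C r`
(`exists_needle_perturbation`). Pairing the forcing of this equation with the adjoint state and
applying Fubini on the triangle `t < s` (`integral_volterra_duality`) yields an exact formula for
the cost difference (`needle_cost_expansion`): linearization remainders of `l₁`, `m` and `f`, plus
the integral over the needle of `p(s) f(s, y + z) (v - u₁)`. After division by `r` the remainders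
vanish, by dominated convergence for those under an integral and by differentiability for that of
`m`. The needle average tends to `P(τ) (v - u₁(τ))` (`tendsto_needle_cost`).

Descent. The minimizer `w` is characterized by `R w = P* (P u₁ + α - P w)`. If `g = P (w - u₁)` were
nonnegative, coercivity would bound `γ ‖w‖²` by `(g - α) ‖P‖ ‖u₁‖`, while the norm of the normal
equation gives `‖P‖ (g - α) ≤ ‖R‖ ‖w‖`. Eliminating `‖w‖` contradicts `‖R‖² ‖u₁‖ < γ ‖P‖ (-α)`
(`regularized_descent`).

Choice of `α`. This condition holds uniformly in time for very negative `α` once `‖P‖` is bounded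
below and `‖u₁‖` above, which compactness of `[0, T]` provides. For `u₁ = 0` it holds for every `α <
0`, and at a single time no uniformity is needed. -/

/-! ### Extension from `[0, T]` to the line, Grönwall, uniform Lipschitz bounds -/

/-- The retraction of `ℝ` onto `[0, T]`. -/
def timeClamp (T t : ℝ) : ℝ := max 0 (min T t)

theorem continuous_timeClamp (T : ℝ) : Continuous (timeClamp T) := by
  unfold timeClamp; fun_prop

theorem timeClamp_mem {T : ℝ} (hT : 0 ≤ T) (t : ℝ) : timeClamp T t ∈ Icc 0 T :=
  ⟨le_max_left _ _, max_le hT (min_le_left _ _)⟩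

theorem timeClamp_of_mem {T t : ℝ} (ht : t ∈ Icc 0 T) : timeClamp T t = t := by
  rw [timeClamp, min_eq_right ht.2, max_eq_right ht.1]

theorem ContinuousOn.comp_timeClamp {X : Type*} [TopologicalSpace X] {g : ℝ → X} {T : ℝ}
    (hT : 0 ≤ T) (hg : ContinuousOn g (Icc 0 T)) : Continuous fun t => g (timeClamp T t) :=
  hg.comp_continuous (continuous_timeClamp T) (timeClamp_mem hT)

theorem intervalIntegral_congr_of_Icc {E : Type*} [NormedAddCommGroup E] [NormedSpace ℝ E]
    {g h : ℝ → E} {a b : ℝ} (hab : a ≤ b) (H : ∀ s ∈ Icc a b, g s = h s) :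
    ∫ s in a..b, g s = ∫ s in a..b, h s :=
  intervalIntegral.integral_congr fun s hs => H s (by rwa [uIcc_of_le hab] at hs)

theorem intervalIntegrable_of_stronglyMeasurable_of_bound {E : Type*} [NormedAddCommGroup E]
    {g : ℝ → E} (hg : StronglyMeasurable g) {C : ℝ} (hC : ∀ s, ‖g s‖ ≤ C) (a b : ℝ) :
    IntervalIntegrable g volume a b :=
  (intervalIntegrable_const (c := C)).mono_fun hg.aestronglyMeasurable
    (Eventually.of_forall fun s => (hC s).trans (le_abs_self C))

/-- Grönwall's inequality in integral form. -/
theorem gronwall_integral {φ : ℝ → ℝ} {T a k : ℝ} (hφ : ContinuousOn φ (Icc 0 T))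
    (ha : 0 ≤ a) (hk : 0 ≤ k) (h : ∀ t ∈ Icc 0 T, φ t ≤ a + k * ∫ s in (0 : ℝ)..t, φ s) :
    ∀ t ∈ Icc 0 T, φ t ≤ a * Real.exp (k * T) := by
  intro t ht
  have hT : 0 ≤ T := ht.1.trans ht.2
  set θ : ℝ → ℝ := fun s => φ (timeClamp T s) with hθ
  have hθc : Continuous θ := hφ.comp_timeClamp hT
  have hθe : ∀ s ∈ Icc 0 T, θ s = φ s := fun s hs => by simp only [hθ, timeClamp_of_mem hs]
  -- The right-hand side is a differentiable majorant, although `φ` is only continuous; `ψ' = k θ ≤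
  -- k ψ` then makes `exp (-k t) ψ` decreasing.
  set ψ : ℝ → ℝ := fun t => a + k * ∫ s in (0 : ℝ)..t, θ s with hψ
  have hψd : ∀ t, HasDerivAt ψ (k * θ t) t := fun t =>
    ((hθc.integral_hasStrictDerivAt 0 t).hasDerivAt.const_mul k).const_add a
  have hle : ∀ s ∈ Icc 0 T, θ s ≤ ψ s := by
    intro s hs
    rw [hθe s hs]
    refine (h s hs).trans (le_of_eq ?_)
    simp only [hψ]
    rw [intervalIntegral_congr_of_Icc hs.1 fun r hr => (hθe r ⟨hr.1, hr.2.trans hs.2⟩).symm]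
  have hd : ∀ t, HasDerivAt (fun t => Real.exp (-(k * t)) * ψ t)
      (Real.exp (-(k * t)) * (k * (θ t - ψ t))) t := by
    intro t
    have h1 : HasDerivAt (fun t : ℝ => Real.exp (-(k * t))) (Real.exp (-(k * t)) * (-(k * 1))) t :=
      (((hasDerivAt_id t).const_mul k).neg).exp
    refine (h1.mul (hψd t)).congr_deriv ?_
    ring
  have hanti : AntitoneOn (fun t => Real.exp (-(k * t)) * ψ t) (Icc 0 T) := by
    refine antitoneOn_of_deriv_nonpos (convex_Icc 0 T)
      (fun t _ => (hd t).continuousAt.continuousWithinAt)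
      (fun t _ => (hd t).differentiableAt.differentiableWithinAt) fun t ht => ?_
    rw [(hd t).deriv]
    rw [interior_Icc] at ht
    have := hle t (Ioo_subset_Icc_self ht)
    exact mul_nonpos_of_nonneg_of_nonpos (Real.exp_nonneg _)
      (mul_nonpos_of_nonneg_of_nonpos hk (by linarith))
  have h0 := hanti (left_mem_Icc.2 hT) ht ht.1
  simp only [hψ, intervalIntegral.integral_same, mul_zero, neg_zero, Real.exp_zero, one_mul,
    add_zero] at h0
  have h1 : ψ t ≤ a * Real.exp (k * t) := by
    have h2 : ψ t = Real.exp (k * t) * (Real.exp (-(k * t)) * ψ t) := by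
      rw [← mul_assoc, ← Real.exp_add]; simp
    rw [h2, mul_comm a]
    exact mul_le_mul_of_nonneg_left h0 (Real.exp_nonneg _)
  rw [← hθe t ht]
  refine (hle t ht).trans (h1.trans ?_)
  gcongr
  exact ht.2

/-- A locally Lipschitz family is uniformly Lipschitz on a tube around a continuous curve. -/
theorem exists_tube_lipschitz {H E : Type*} [NormedAddCommGroup H] [NormedAddCommGroup E]
    {T : ℝ} {g : ℝ → H → E} {y : ℝ → H} (hy : ContinuousOn y (Icc 0 T))
    (hg : ∀ t ∈ Icc 0 T, ∀ y : H, ∃ ε > 0, ∃ L : ℝ, ∀ s ∈ Icc 0 T, |s - t| < ε →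
      ∀ z ∈ Metric.ball y ε, ∀ w ∈ Metric.ball y ε, ‖g s z - g s w‖ ≤ L * ‖z - w‖) :
    ∃ δ > 0, ∃ L ≥ 0, ∀ s ∈ Icc 0 T, ∀ z ∈ Metric.ball (y s) δ, ∀ w ∈ Metric.ball (y s) δ,
      ‖g s z - g s w‖ ≤ L * ‖z - w‖ := by
  -- Compactness induction: the property passes to subsets and to unions (smaller radius, larger
  -- constant), so it need only hold near each time.
  refine isCompact_Icc.induction_on (p := fun A => ∃ δ > 0, ∃ L ≥ 0, ∀ s ∈ A,
    ∀ z ∈ Metric.ball (y s) δ, ∀ w ∈ Metric.ball (y s) δ, ‖g s z - g s w‖ ≤ L * ‖z - w‖)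
    ⟨1, one_pos, 0, le_rfl, by simp⟩ ?_ ?_ ?_
  · rintro A B hAB ⟨δ, hδ, L, hL, h⟩
    exact ⟨δ, hδ, L, hL, fun s hs => h s (hAB hs)⟩
  · rintro A B ⟨δ, hδ, L, hL, h⟩ ⟨δ', hδ', L', hL', h'⟩
    refine ⟨min δ δ', lt_min hδ hδ', max L L', hL.trans (le_max_left _ _), fun s hs z hz w hw => ?_⟩
    rcases hs with hs | hs
    · refine (h s hs z (Metric.ball_subset_ball (min_le_left _ _) hz) w
        (Metric.ball_subset_ball (min_le_left _ _) hw)).trans ?_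
      gcongr
      exact le_max_left _ _
    · refine (h' s hs z (Metric.ball_subset_ball (min_le_right _ _) hz) w
        (Metric.ball_subset_ball (min_le_right _ _) hw)).trans ?_
      gcongr
      exact le_max_right _ _
  · intro t ht
    obtain ⟨ε, hε, L, h⟩ := hg t ht (y t)
    obtain ⟨η, hη, hyη⟩ := Metric.continuousWithinAt_iff.1 (hy t ht) (ε / 2) (half_pos hε)
    -- Near `t` the curve moves by less than `ε / 2`, so balls of radius `ε / 2` about `y s` stay
    -- inside the ball of radius `ε` about `y t`.
    refine ⟨Icc 0 T ∩ Metric.ball t (min ε η),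
      inter_mem_nhdsWithin _ (Metric.ball_mem_nhds t (lt_min hε hη)), ε / 2, half_pos hε,
      max L 0, le_max_right _ _, fun s hs z hz w hw => ?_⟩
    have hs2 : dist s t < min ε η := hs.2
    have hd := hyη hs.1 (hs2.trans_le (min_le_right _ _))
    have hsub : Metric.ball (y s) (ε / 2) ⊆ Metric.ball (y t) ε :=
      Metric.ball_subset_ball' (by linarith)
    refine (h s hs.1 (hs2.trans_le (min_le_left _ _)) z (hsub hz) w (hsub hw)).trans ?_
    gcongr
    exact le_max_left _ _

/-- Along two continuous curves, a jointly continuous and locally Lipschitz family satisfies a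
uniform Lipschitz estimate. -/
theorem exists_lipschitz_along_curves {H E : Type*} [NormedAddCommGroup H] [NormedAddCommGroup E]
    {T : ℝ} {g : ℝ → H → E} {y y' : ℝ → H} (hy : ContinuousOn y (Icc 0 T))
    (hy' : ContinuousOn y' (Icc 0 T)) (hgy : ContinuousOn (fun s => g s (y s)) (Icc 0 T))
    (hgy' : ContinuousOn (fun s => g s (y' s)) (Icc 0 T))
    (hg : ∀ t ∈ Icc 0 T, ∀ y : H, ∃ ε > 0, ∃ L : ℝ, ∀ s ∈ Icc 0 T, |s - t| < ε →
      ∀ z ∈ Metric.ball y ε, ∀ w ∈ Metric.ball y ε, ‖g s z - g s w‖ ≤ L * ‖z - w‖) :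
    ∃ L ≥ 0, ∀ s ∈ Icc 0 T, ‖g s (y s) - g s (y' s)‖ ≤ L * ‖y s - y' s‖ := by
  refine isCompact_Icc.induction_on (p := fun A => ∃ L ≥ 0, ∀ s ∈ A,
    ‖g s (y s) - g s (y' s)‖ ≤ L * ‖y s - y' s‖) ⟨0, le_rfl, by simp⟩ ?_ ?_ ?_
  · rintro A B hAB ⟨L, hL, h⟩
    exact ⟨L, hL, fun s hs => h s (hAB hs)⟩
  · rintro A B ⟨L, hL, h⟩ ⟨L', hL', h'⟩
    refine ⟨max L L', hL.trans (le_max_left _ _), fun s hs => ?_⟩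
    rcases hs with hs | hs
    · refine (h s hs).trans ?_
      gcongr
      exact le_max_left _ _
    · refine (h' s hs).trans ?_
      gcongr
      exact le_max_right _ _
  · intro t ht
    -- Where the curves meet, both are locally in one Lipschitz ball. Where they differ, their
    -- distance stays away from zero and the difference of the values is locally bounded, so the
    -- quotient is bounded. The curves need not be close to each other.
    by_cases hyt : y t = y' t
    · obtain ⟨ε, hε, L, h⟩ := hg t ht (y t)
      have e1 : ∀ᶠ s in 𝓝[Icc 0 T] t, y s ∈ Metric.ball (y t) ε :=
        (hy t ht) (Metric.ball_mem_nhds _ hε)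
      have e2 : ∀ᶠ s in 𝓝[Icc 0 T] t, y' s ∈ Metric.ball (y t) ε := by
        rw [hyt]; exact (hy' t ht) (Metric.ball_mem_nhds _ hε)
      have e3 : ∀ᶠ s in 𝓝[Icc 0 T] t, |s - t| < ε :=
        mem_nhdsWithin_of_mem_nhds (Metric.ball_mem_nhds t hε)
      refine ⟨_, (e1.and (e2.and (e3.and self_mem_nhdsWithin))), max L 0, le_max_right _ _, ?_⟩
      rintro s ⟨h1, h2, h3, h4⟩
      refine (h s h4 h3 _ h1 _ h2).trans ?_
      gcongr
      exact le_max_left _ _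
    · have hpos : 0 < ‖y t - y' t‖ := norm_pos_iff.2 (sub_ne_zero.2 hyt)
      have e1 : ∀ᶠ s in 𝓝[Icc 0 T] t, ‖y t - y' t‖ / 2 < ‖y s - y' s‖ :=
        ((hy t ht).sub (hy' t ht)).norm.eventually (lt_mem_nhds (half_lt_self hpos))
      have e2 : ∀ᶠ s in 𝓝[Icc 0 T] t,
          ‖g s (y s) - g s (y' s)‖ < ‖g t (y t) - g t (y' t)‖ + 1 :=
        ((hgy t ht).sub (hgy' t ht)).norm.eventually (gt_mem_nhds (lt_add_one _))
      refine ⟨_, e1.and e2, (‖g t (y t) - g t (y' t)‖ + 1) / (‖y t - y' t‖ / 2), by positivity, ?_⟩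
      rintro s ⟨h1, h2⟩
      refine h2.le.trans ?_
      rw [div_mul_eq_mul_div, le_div_iff₀ (by positivity)]
      gcongr

/-! ### Radial truncation in a normed space -/

/-- The radial retraction onto the closed ball of radius `δ`. -/
noncomputable def radialRetraction {H : Type*} [NormedAddCommGroup H] [NormedSpace ℝ H] (δ : ℝ)
    (x : H) : H :=
  (δ / max δ ‖x‖) • x

section radialRetraction

variable {H : Type*} [NormedAddCommGroup H] [NormedSpace ℝ H] {δ : ℝ}

theorem radialRetraction_of_norm_le (hδ : 0 < δ) {x : H} (hx : ‖x‖ ≤ δ) :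
    radialRetraction δ x = x := by
  rw [radialRetraction, max_eq_left hx, div_self hδ.ne', one_smul]

theorem norm_radialRetraction_le (hδ : 0 < δ) (x : H) : ‖radialRetraction δ x‖ ≤ δ := by
  have hm : 0 < max δ ‖x‖ := lt_max_of_lt_left hδ
  rw [radialRetraction, norm_smul, Real.norm_of_nonneg (by positivity), div_mul_eq_mul_div,
    div_le_iff₀ hm]
  gcongr
  exact le_max_right _ _

theorem norm_radialRetraction_le_norm (hδ : 0 < δ) (x : H) : ‖radialRetraction δ x‖ ≤ ‖x‖ := by
  have hm : 0 < max δ ‖x‖ := lt_max_of_lt_left hδ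
  rw [radialRetraction, norm_smul, Real.norm_of_nonneg (by positivity)]
  exact mul_le_of_le_one_left (norm_nonneg _) ((div_le_one hm).2 (le_max_left _ _))

/-- The difference splits into a change of the vector and a change of the scaling factor, each
contributing at most `‖x - w‖`. The constant 2 needs no inner product. -/
theorem norm_radialRetraction_sub_le (hδ : 0 < δ) (x w : H) :
    ‖radialRetraction δ x - radialRetraction δ w‖ ≤ 2 * ‖x - w‖ := by
  have hx : 0 < max δ ‖x‖ := lt_max_of_lt_left hδ
  have hw : 0 < max δ ‖w‖ := lt_max_of_lt_left hδ
  have e : radialRetraction δ x - radialRetraction δ w =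
      (δ / max δ ‖x‖) • (x - w) + (δ / max δ ‖x‖ - δ / max δ ‖w‖) • w := by
    simp only [radialRetraction]; module
  have h1 : δ / max δ ‖x‖ ≤ 1 := (div_le_one hx).2 (le_max_left _ _)
  have h2 : ‖w‖ / max δ ‖w‖ ≤ 1 := (div_le_one hw).2 (le_max_right _ _)
  have h3 : |max δ ‖w‖ - max δ ‖x‖| ≤ ‖x - w‖ := by
    rw [max_comm δ, max_comm δ, norm_sub_rev]
    exact (abs_max_sub_max_le_abs _ _ _).trans (abs_norm_sub_norm_le w x)
  have e2 : (δ / max δ ‖x‖ - δ / max δ ‖w‖) =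
      (δ / max δ ‖x‖) * ((max δ ‖w‖ - max δ ‖x‖) / max δ ‖w‖) := by
    field_simp
  rw [e, two_mul]
  refine (norm_add_le _ _).trans (add_le_add ?_ ?_)
  · rw [norm_smul, Real.norm_of_nonneg (by positivity)]
    exact mul_le_of_le_one_left (norm_nonneg _) h1
  · rw [e2, norm_smul, Real.norm_eq_abs, abs_mul, abs_div _ (max δ ‖w‖), abs_of_pos hw,
      abs_of_nonneg (show 0 ≤ δ / max δ ‖x‖ by positivity), mul_assoc, div_mul_eq_mul_div _ _ ‖w‖,
      mul_div_assoc _ ‖w‖]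
    calc δ / max δ ‖x‖ * (|max δ ‖w‖ - max δ ‖x‖| * (‖w‖ / max δ ‖w‖))
        ≤ 1 * (‖x - w‖ * 1) := by gcongr
      _ = ‖x - w‖ := by ring

theorem continuous_radialRetraction (hδ : 0 < δ) :
    Continuous (radialRetraction δ : H → H) := by
  unfold radialRetraction
  refine (continuous_const.div (by fun_prop) fun x => ?_).smul continuous_id
  exact (lt_max_of_lt_left hδ).ne'

end radialRetraction

/-! ### Volterra equations with a bounded, strongly continuous kernel -/

section VolterraKernel

variable {H : Type*} [NormedAddCommGroup H] [NormedSpace ℝ H] {K : ℝ → H →L[ℝ] H} {M C : ℝ}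

theorem stronglyMeasurable_kernel_apply (hK : Continuous fun q : ℝ × H => K q.1 q.2) {w : ℝ → H}
    (hw : StronglyMeasurable w) :
    StronglyMeasurable fun q : ℝ × ℝ => K (q.1 - q.2) (w q.2) := by
  have h1 : StronglyMeasurable fun q : ℝ × ℝ => q.1 - q.2 :=
    (continuous_fst.sub continuous_snd).stronglyMeasurable
  exact hK.comp_stronglyMeasurable (h1.prodMk (hw.comp_measurable measurable_snd))

theorem stronglyMeasurable_kernel_apply_left (hK : Continuous fun q : ℝ × H => K q.1 q.2)
    {w : ℝ → H} (hw : StronglyMeasurable w) (t : ℝ) :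
    StronglyMeasurable fun s : ℝ => K (t - s) (w s) :=
  (stronglyMeasurable_kernel_apply hK hw).comp_measurable (measurable_const.prodMk measurable_id)

theorem norm_kernel_apply_le (hM : ∀ r, ‖K r‖ ≤ M) {w : ℝ → H} (hC : ∀ s, ‖w s‖ ≤ C) (r s : ℝ) :
    ‖K r (w s)‖ ≤ M * C :=
  ((K r).le_of_opNorm_le (hM r) _).trans
    (mul_le_mul_of_nonneg_left (hC s) ((norm_nonneg _).trans (hM r)))

theorem intervalIntegrable_kernel_apply (hK : Continuous fun q : ℝ × H => K q.1 q.2)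
    (hM : ∀ r, ‖K r‖ ≤ M) {w : ℝ → H} (hw : StronglyMeasurable w) (hC : ∀ s, ‖w s‖ ≤ C)
    (t a b : ℝ) : IntervalIntegrable (fun s => K (t - s) (w s)) volume a b :=
  intervalIntegrable_of_stronglyMeasurable_of_bound
    (stronglyMeasurable_kernel_apply_left hK hw t) (fun s => norm_kernel_apply_le hM hC _ s) a b

/-- Here `t` is both the upper limit and a kernel parameter. The two roles are decoupled, continuity
in both variables follows by domination by `M * C`, and the result is restricted to the diagonal. -/
theorem continuous_volterra_integral (hK : Continuous fun q : ℝ × H => K q.1 q.2)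
    (hM : ∀ r, ‖K r‖ ≤ M) {w : ℝ → H} (hw : StronglyMeasurable w) (hC : ∀ s, ‖w s‖ ≤ C) :
    Continuous fun t => ∫ s in (0 : ℝ)..t, K (t - s) (w s) := by
  rw [continuous_iff_continuousAt]
  intro t₀
  have h : ContinuousAt (fun p : ℝ × ℝ => ∫ s in (0 : ℝ)..p.2, K (p.1 - s) (w s)) (t₀, t₀) := by
    refine intervalIntegral.continuousAt_parametric_primitive_of_dominated (fun _ => M * C)
      (-|t₀| - 1) (|t₀| + 1)
      (fun t => (stronglyMeasurable_kernel_apply_left hK hw t).aestronglyMeasurable)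
      (Eventually.of_forall fun t => Eventually.of_forall fun s => norm_kernel_apply_le hM hC _ s)
      intervalIntegrable_const (Eventually.of_forall fun s => ?_) ?_ ?_ (by simp)
    · have : Continuous fun t : ℝ => K (t - s) (w s) :=
        hK.comp ((continuous_id.sub continuous_const).prodMk continuous_const)
      exact this.continuousAt
    · constructor <;> linarith [abs_nonneg t₀]
    · constructor <;> linarith [neg_abs_le t₀, le_abs_self t₀]
  exact ContinuousAt.comp (f := fun t : ℝ => (t, t)) h (by fun_prop)

/-- This is the gain from an exponentially weighted norm: integration costs a factor `k⁻¹`, small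
for large `k`. -/
theorem integral_exp_mul_le {k t : ℝ} (hk : 0 < k) :
    Real.exp (-(k * t)) * ∫ s in (0 : ℝ)..t, Real.exp (k * s) ≤ k⁻¹ := by
  have : ∫ s in (0 : ℝ)..t, Real.exp (k * s) = k⁻¹ * (Real.exp (k * t) - 1) := by
    rw [intervalIntegral.integral_comp_mul_left (fun x => Real.exp x) hk.ne', integral_exp]
    simp
  rw [this, Real.exp_neg]
  have := Real.exp_pos (k * t)
  field_simp
  linarith

/-- Nonlinear Volterra equations with bounded, globally Lipschitz right-hand side are solvable. -/
theorem exists_volterra_solution [CompleteSpace H] (hK : Continuous fun q : ℝ × H => K q.1 q.2)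
    (hM : ∀ r, ‖K r‖ ≤ M) {T : ℝ} (hT : 0 ≤ T) {G : ℝ → H → H} {L : ℝ} (hL : 0 ≤ L)
    (hGm : ∀ z : ℝ → H, Continuous z → StronglyMeasurable fun s => G s (z s))
    (hGC : ∀ s x, ‖G s x‖ ≤ C) (hGL : ∀ s x x', ‖G s x - G s x'‖ ≤ L * ‖x - x'‖) :
    ∃ z : ℝ → H, Continuous z ∧
      ∀ t ∈ Icc 0 T, z t = ∫ s in (0 : ℝ)..t, K (t - s) (G s (z s)) := by
  have hM0 : 0 ≤ M := (norm_nonneg _).trans (hM 0)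
  -- The weight is chosen so that `M * L / k ≤ 1 / 2`; the added 1 keeps `k` positive when `M * L =
  -- 0`.
  set k : ℝ := 2 * (M * L) + 1 with hk
  have hk0 : 0 < k := by positivity
  -- The unknown is rescaled by `exp (k s)`, so that the plain supremum norm of `ζ` is the weighted
  -- norm of the solution and the contraction works on all of `[0, T]` at once.
  let ext : C(Icc 0 T, H) → ℝ → H := fun ζ s => Real.exp (k * s) • ζ (projIcc 0 T hT s)
  have hext : ∀ ζ, Continuous (ext ζ) := fun ζ => by
    have : Continuous fun s => ζ (projIcc 0 T hT s) := ζ.continuous.comp continuous_projIcc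
    fun_prop
  let Ψ : C(Icc 0 T, H) → C(Icc 0 T, H) := fun ζ =>
    ⟨fun t => Real.exp (-(k * t)) • ∫ s in (0 : ℝ)..t, K (t - s) (G s (ext ζ s)), by
      have := (continuous_volterra_integral hK hM (hGm _ (hext ζ)) fun s => hGC s _).comp
        (continuous_subtype_val (p := fun t => t ∈ Icc 0 T))
      exact Continuous.smul (by fun_prop) this⟩
  have hint : ∀ ζ (t a b : ℝ), IntervalIntegrable (fun s => K (t - s) (G s (ext ζ s))) volume a b :=
    fun ζ t a b => intervalIntegrable_kernel_apply hK hM (hGm _ (hext ζ)) (fun s => hGC s _) t a b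
  have hcontr : ContractingWith (1 / 2) Ψ := by
    refine ⟨by norm_num, LipschitzWith.of_dist_le_mul fun ζ ζ' => ?_⟩
    rw [ContinuousMap.dist_le (by positivity)]
    intro t
    have ht := t.2
    have h1 : ‖∫ s in (0 : ℝ)..t, (K (t - s) (G s (ext ζ s)) - K (t - s) (G s (ext ζ' s)))‖ ≤
        ∫ s in (0 : ℝ)..t, M * L * dist ζ ζ' * Real.exp (k * s) := by
      refine intervalIntegral.norm_integral_le_of_norm_le ht.1
        (Eventually.of_forall fun s hs => ?_) (Continuous.intervalIntegrable (by fun_prop) _ _)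
      rw [← map_sub]
      calc ‖K (t - s) (G s (ext ζ s) - G s (ext ζ' s))‖
          ≤ M * ‖G s (ext ζ s) - G s (ext ζ' s)‖ := (K _).le_of_opNorm_le (hM _) _
        _ ≤ M * (L * ‖ext ζ s - ext ζ' s‖) := by gcongr; exact hGL _ _ _
        _ ≤ M * (L * (Real.exp (k * s) * dist ζ ζ')) := by
            gcongr
            simp only [ext]
            rw [← smul_sub, norm_smul, Real.norm_of_nonneg (Real.exp_nonneg _), ← dist_eq_norm]
            gcongr
            exact ContinuousMap.dist_apply_le_dist _
        _ = M * L * dist ζ ζ' * Real.exp (k * s) := by ring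
    rw [dist_eq_norm]
    simp only [Ψ, ContinuousMap.coe_mk]
    rw [← smul_sub, ← intervalIntegral.integral_sub (hint _ _ _ _) (hint _ _ _ _), norm_smul,
      Real.norm_of_nonneg (Real.exp_nonneg _)]
    calc _ ≤ Real.exp (-(k * t)) * ∫ s in (0 : ℝ)..t, M * L * dist ζ ζ' * Real.exp (k * s) := by
          gcongr
      _ = M * L * dist ζ ζ' * (Real.exp (-(k * t)) * ∫ s in (0 : ℝ)..t, Real.exp (k * s)) := by
          rw [intervalIntegral.integral_const_mul]; ring
      _ ≤ M * L * dist ζ ζ' * k⁻¹ := by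
          gcongr
          exact integral_exp_mul_le hk0
      _ = (M * L * k⁻¹) * dist ζ ζ' := by ring
      _ ≤ _ := by
          gcongr
          rw [← div_eq_mul_inv, div_le_iff₀ hk0, hk]
          push_cast
          linarith
  have hfix : Ψ (hcontr.fixedPoint Ψ) = hcontr.fixedPoint Ψ := hcontr.fixedPoint_isFixedPt
  refine ⟨ext (hcontr.fixedPoint Ψ), hext _, fun t ht => ?_⟩
  have := congrArg (fun ζ : C(Icc 0 T, H) => Real.exp (k * t) • ζ ⟨t, ht⟩) hfix
  simp only [Ψ, ContinuousMap.coe_mk, smul_smul, ← Real.exp_add, add_neg_cancel, Real.exp_zero,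
    one_smul] at this
  rw [this]
  simp only [ext]
  rw [projIcc_of_mem hT ht]

/-- Duality between a Volterra convolution and its transpose. -/
theorem integral_volterra_duality [CompleteSpace H] (hK : Continuous fun q : ℝ × H => K q.1 q.2)
    (hM : ∀ r, ‖K r‖ ≤ M) {T : ℝ} (hT : 0 ≤ T) {w : ℝ → H} (hw : StronglyMeasurable w)
    (hC : ∀ s, ‖w s‖ ≤ C) {q : ℝ → StrongDual ℝ H} {Q : ℝ} (hQ : ∀ s, ‖q s‖ ≤ Q)
    (hq : StronglyMeasurable fun x : ℝ × ℝ => q x.1 (K (x.1 - x.2) (w x.2)))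
    {μ : StrongDual ℝ H} {p : ℝ → StrongDual ℝ H}
    (hp : ∀ t ∈ Icc 0 T, IntervalIntegrable (fun s => (q s).comp (K (s - t))) volume t T ∧
      p t = μ.comp (K (T - t)) + ∫ s in t..T, (q s).comp (K (s - t))) :
    ∫ t in (0 : ℝ)..T, p t (w t) = μ (∫ t in (0 : ℝ)..T, K (T - t) (w t)) +
      ∫ s in (0 : ℝ)..T, q s (∫ t in (0 : ℝ)..s, K (s - t) (w t)) := by
  set ν : Measure ℝ := volume.restrict (Ioc 0 T) with hν
  have hQ0 : 0 ≤ Q := (norm_nonneg _).trans (hQ 0)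
  -- The integrand is cut off to the triangle `t < s`. Integrating it in `t` first gives the
  -- convolution, and in `s` first the integral term of `p`; the diagonal is a null set.
  set Φ : ℝ × ℝ → ℝ := {x : ℝ × ℝ | x.2 < x.1}.indicator
    (fun x => q x.1 (K (x.1 - x.2) (w x.2))) with hΦ
  have hΦm : StronglyMeasurable Φ :=
    hq.indicator (measurableSet_lt measurable_snd measurable_fst)
  have hb : ∀ s t, ‖q s (K (s - t) (w t))‖ ≤ Q * (M * C) := fun s t =>
    ((q s).le_of_opNorm_le (hQ s) _).trans
      (mul_le_mul_of_nonneg_left (norm_kernel_apply_le hM hC _ t) hQ0)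
  have hΦb : ∀ x, ‖Φ x‖ ≤ Q * (M * C) := fun x =>
    (norm_indicator_le_norm_self _ _).trans (hb _ _)
  have hΦi : Integrable (Function.uncurry fun s t => Φ (s, t)) (ν.prod ν) :=
    Integrable.of_bound hΦm.aestronglyMeasurable _ (Eventually.of_forall fun x => hΦb x)
  have hswap := integral_integral_swap hΦi
  have hΦi2 : Integrable (fun t => ∫ s, Φ (s, t) ∂ν) ν := hΦi.integral_prod_right
  have e1 : ∀ s ∈ Ioc 0 T, ∫ t, Φ (s, t) ∂ν = q s (∫ t in (0 : ℝ)..s, K (s - t) (w t)) := by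
    intro s hs
    rw [← ContinuousLinearMap.intervalIntegral_comp_comm _
      (intervalIntegrable_kernel_apply hK hM hw hC _ _ _),
      intervalIntegral.integral_of_le hs.1.le]
    have : (fun t => Φ (s, t)) = (Iio s).indicator fun t => q s (K (s - t) (w t)) := by
      ext t; simp [hΦ, indicator]
    rw [this, integral_indicator measurableSet_Iio, hν, Measure.restrict_restrict measurableSet_Iio]
    have hset : Iio s ∩ Ioc 0 T = Ioo 0 s := by
      ext t
      simp only [mem_inter_iff, mem_Iio, mem_Ioc, mem_Ioo]
      exact ⟨fun h => ⟨h.2.1, h.1⟩, fun h => ⟨h.2, h.1, h.2.le.trans hs.2⟩⟩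
    rw [hset, integral_Ioc_eq_integral_Ioo]
  have e2 : ∀ t ∈ Ioc 0 T, p t (w t) = μ (K (T - t) (w t)) + ∫ s, Φ (s, t) ∂ν := by
    intro t ht
    obtain ⟨hi, hpt⟩ := hp t (Ioc_subset_Icc_self ht)
    rw [hpt, add_apply, ContinuousLinearMap.intervalIntegral_apply hi,
      intervalIntegral.integral_of_le ht.2]
    congr 1
    have : (fun s => Φ (s, t)) = (Ioi t).indicator fun s => q s (K (s - t) (w t)) := by
      ext t; simp [hΦ, indicator]
    rw [this, integral_indicator measurableSet_Ioi, hν, Measure.restrict_restrict measurableSet_Ioi]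
    simp only [ContinuousLinearMap.comp_apply]
    congr 2
    ext s
    simp only [mem_inter_iff, mem_Ioi, mem_Ioc]
    exact ⟨fun h => ⟨h.1, ht.1.trans h.1, h.2⟩, fun h => ⟨h.1, h.2.2⟩⟩
  rw [intervalIntegral.integral_of_le hT, intervalIntegral.integral_of_le hT (μ := volume)
    (f := fun s => q s _), setIntegral_congr_fun measurableSet_Ioc e2,
    setIntegral_congr_fun measurableSet_Ioc fun s hs => (e1 s hs).symm, hswap, integral_add _ hΦi2,
    ← ContinuousLinearMap.intervalIntegral_comp_comm _
      (intervalIntegrable_kernel_apply hK hM hw hC _ _ _), intervalIntegral.integral_of_le hT]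
  refine Integrable.of_bound (C := ‖μ‖ * (M * C))
    (μ.continuous.comp_stronglyMeasurable
      (stronglyMeasurable_kernel_apply_left hK hw T)).aestronglyMeasurable
    (Eventually.of_forall fun t => ?_)
  exact (μ.le_opNorm _).trans
    (mul_le_mul_of_nonneg_left (norm_kernel_apply_le hM hC _ t) (norm_nonneg _))

end VolterraKernel

/-! ### Linearization remainders and needle averages -/

theorem eventually_const_mul_lt {C δ : ℝ} (hδ : 0 < δ) : ∀ᶠ r in 𝓝[>] (0 : ℝ), C * r < δ := by
  have : Tendsto (fun r : ℝ => C * r) (𝓝 0) (𝓝 (C * 0)) := (continuous_const_mul C).tendsto 0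
  rw [mul_zero] at this
  exact (this.mono_left nhdsWithin_le_nhds).eventually (gt_mem_nhds hδ)

theorem tendsto_inv_smul_of_isLittleO {H E : Type*}
    [NormedAddCommGroup H] [NormedAddCommGroup E] [NormedSpace ℝ E] {ψ : H → E}
    (hψ : ψ =o[𝓝 0] fun x => x) {z : ℝ → H} {C : ℝ}
    (hzb : ∀ᶠ r in 𝓝[>] (0 : ℝ), ‖z r‖ ≤ C * r) :
    Tendsto (fun r => r⁻¹ • ψ (z r)) (𝓝[>] 0) (𝓝 0) := by
  have hO : z =O[𝓝[>] (0 : ℝ)] fun r => r := by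
    refine Asymptotics.IsBigO.of_bound C ?_
    filter_upwards [hzb, self_mem_nhdsWithin] with r hr hr0
    rwa [Real.norm_of_nonneg (le_of_lt hr0)]
  have hz0 : Tendsto z (𝓝[>] 0) (𝓝 0) :=
    hO.trans_tendsto (tendsto_id.mono_left nhdsWithin_le_nhds)
  have ho : (fun r => ψ (z r)) =o[𝓝[>] (0 : ℝ)] fun r => r := (hψ.comp_tendsto hz0).trans_isBigO hO
  exact ho.tendsto_inv_smul_nhds_zero

section Linearization

variable {H E : Type*} [NormedAddCommGroup H] [NormedSpace ℝ H] [NormedAddCommGroup E]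
  [NormedSpace ℝ E] {g : ℝ → H → E} {y : ℝ → H} {δ L : ℝ}

/-- The derivative in the state is not assumed continuous in time. Measurability comes from writing
it as a pointwise limit of difference quotients with step `1 / n`. -/
theorem stronglyMeasurable_fderiv_apply_along (hg : Continuous fun q : ℝ × H => g q.1 q.2)
    (hy : Continuous y) (hd : ∀ s, DifferentiableAt ℝ (g s) (y s)) {α : Type*} [MeasurableSpace α]
    {a : α → ℝ} {k : α → H} (ha : StronglyMeasurable a) (hk : StronglyMeasurable k) :
    StronglyMeasurable fun x => fderiv ℝ (g (a x)) (y (a x)) (k x) := by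
  have hya : StronglyMeasurable fun x => y (a x) := hy.comp_stronglyMeasurable ha
  refine stronglyMeasurable_of_tendsto (u := atTop) (f := fun (n : ℕ) x =>
    (n : ℝ) • (g (a x) (y (a x) + (n : ℝ)⁻¹ • k x) - g (a x) (y (a x)))) (fun n => ?_) ?_
  · exact ((hg.comp_stronglyMeasurable (ha.prodMk (hya.add (hk.const_smul _)))).sub
      (hg.comp_stronglyMeasurable (ha.prodMk hya))).const_smul _
  · rw [tendsto_pi_nhds]
    intro x
    refine (hd (a x)).hasFDerivAt.lim_real (k x) |>.comp tendsto_natCast_atTop_atTop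

theorem norm_fderiv_le_of_tube (hδ : 0 < δ) (hL : 0 ≤ L)
    (hlip : ∀ s, ∀ x ∈ Metric.ball (y s) δ, ∀ w ∈ Metric.ball (y s) δ,
      ‖g s x - g s w‖ ≤ L * ‖x - w‖) (s : ℝ) : ‖fderiv ℝ (g s) (y s)‖ ≤ L := by
  refine norm_fderiv_le_of_lip' ℝ hL ?_
  filter_upwards [Metric.ball_mem_nhds (y s) hδ] with x hx
  exact hlip s x hx _ (Metric.mem_ball_self hδ)

/-- The linearization remainder along a curve. -/
noncomputable def linRem (g : ℝ → H → E) (y : ℝ → H) (s : ℝ) (x : H) : E :=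
  g s (y s + x) - g s (y s) - fderiv ℝ (g s) (y s) x

theorem stronglyMeasurable_linRem (hg : Continuous fun q : ℝ × H => g q.1 q.2)
    (hy : Continuous y) (hd : ∀ s, DifferentiableAt ℝ (g s) (y s)) {z : ℝ → H}
    (hz : Continuous z) : StronglyMeasurable fun s => linRem g y s (z s) := by
  have h1 : Continuous fun s => g s (y s + z s) - g s (y s) :=
    (hg.comp (continuous_id.prodMk (hy.add hz))).sub (hg.comp (continuous_id.prodMk hy))
  exact h1.stronglyMeasurable.sub (stronglyMeasurable_fderiv_apply_along hg hy hd
    stronglyMeasurable_id hz.stronglyMeasurable)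

theorem norm_linRem_le (hδ : 0 < δ) (hL : 0 ≤ L)
    (hlip : ∀ s, ∀ x ∈ Metric.ball (y s) δ, ∀ w ∈ Metric.ball (y s) δ,
      ‖g s x - g s w‖ ≤ L * ‖x - w‖) {s : ℝ} {x : H} (hx : ‖x‖ < δ) :
    ‖linRem g y s x‖ ≤ 2 * L * ‖x‖ := by
  have h1 : ‖g s (y s + x) - g s (y s)‖ ≤ L * ‖x‖ := by
    simpa using hlip s (y s + x) (by simpa using hx) (y s) (Metric.mem_ball_self hδ)
  have h2 : ‖fderiv ℝ (g s) (y s) x‖ ≤ L * ‖x‖ :=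
    ContinuousLinearMap.le_of_opNorm_le _ (norm_fderiv_le_of_tube hδ hL hlip s) x
  calc _ ≤ _ := norm_sub_le _ _
    _ ≤ L * ‖x‖ + L * ‖x‖ := add_le_add h1 h2
    _ = _ := by ring

theorem isLittleO_linRem {s : ℝ} (hd : DifferentiableAt ℝ (g s) (y s)) :
    linRem g y s =o[𝓝 0] fun x => x :=
  hasFDerivAt_iff_isLittleO_nhds_zero.1 hd.hasFDerivAt

/-- Linearization remainders of perturbations of size `O(r)` are `o(r)` in `L¹`. -/
theorem tendsto_integral_linRem (hg : Continuous fun q : ℝ × H => g q.1 q.2)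
    (hy : Continuous y) (hd : ∀ s, DifferentiableAt ℝ (g s) (y s)) (hδ : 0 < δ) (hL : 0 ≤ L)
    (hlip : ∀ s, ∀ x ∈ Metric.ball (y s) δ, ∀ w ∈ Metric.ball (y s) δ,
      ‖g s x - g s w‖ ≤ L * ‖x - w‖) {z : ℝ → ℝ → H} {C : ℝ}
    (hz : ∀ᶠ r in 𝓝[>] (0 : ℝ), Continuous (z r))
    (hzb : ∀ᶠ r in 𝓝[>] (0 : ℝ), ∀ s, ‖z r s‖ ≤ C * r) (T : ℝ) :
    Tendsto (fun r => r⁻¹ * ∫ s in (0 : ℝ)..T, ‖linRem g y s (z r s)‖) (𝓝[>] 0) (𝓝 0) := by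
  -- The little-o is not uniform in `s`, so dominated convergence is used: pointwise convergence
  -- from differentiability, domination by `2 * L * C` from the tube Lipschitz bound.
  have key : Tendsto (fun r => ∫ s in (0 : ℝ)..T, ‖r⁻¹ • linRem g y s (z r s)‖) (𝓝[>] 0)
      (𝓝 (∫ s in (0 : ℝ)..T, (0 : ℝ))) := by
    refine intervalIntegral.tendsto_integral_filter_of_dominated_convergence
      (fun _ => 2 * L * C) ?_ ?_ intervalIntegrable_const ?_
    · filter_upwards [hz] with r hr
      exact ((stronglyMeasurable_linRem hg hy hd hr).const_smul _).norm.aestronglyMeasurable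
    · filter_upwards [hzb, eventually_const_mul_lt (C := C) hδ, self_mem_nhdsWithin] with r hr hrδ hr0
      refine Eventually.of_forall fun s _ => ?_
      have hr0' : 0 < r := hr0
      rw [norm_norm, norm_smul, norm_inv, Real.norm_of_nonneg hr0'.le, inv_mul_le_iff₀ hr0']
      refine (norm_linRem_le hδ hL hlip ((hr s).trans_lt hrδ)).trans ?_
      calc 2 * L * ‖z r s‖ ≤ 2 * L * (C * r) := by gcongr; exact hr s
        _ = _ := by ring
    · refine Eventually.of_forall fun s _ => ?_
      have := (tendsto_inv_smul_of_isLittleO (isLittleO_linRem (hd s))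
        (hzb.mono fun r hr => hr s)).norm
      simpa using this
  rw [intervalIntegral.integral_zero] at key
  refine key.congr' ?_
  filter_upwards [self_mem_nhdsWithin] with r hr
  have hr0' : 0 < r := hr
  rw [← intervalIntegral.integral_const_mul]
  simp only [norm_smul, norm_inv, Real.norm_of_nonneg hr0'.le]

end Linearization

/-- Averages over shrinking intervals of functions that become constant. -/
theorem tendsto_needle_average {T τ c : ℝ} (hτ : τ ∈ Ioo 0 T) {h : ℝ → ℝ → ℝ}
    (hm : ∀ᶠ r in 𝓝[>] (0 : ℝ), StronglyMeasurable (h r))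
    (hc : ∀ ε > 0, ∀ᶠ r in 𝓝[>] (0 : ℝ), ∀ s ∈ Icc (τ - r / 2) (τ + r / 2), |h r s - c| ≤ ε) :
    Tendsto (fun r => r⁻¹ * ∫ s in (0 : ℝ)..T, (Icc (τ - r / 2) (τ + r / 2)).indicator (h r) s)
      (𝓝[>] 0) (𝓝 c) := by
  rw [Metric.tendsto_nhds]
  intro ε hε
  -- For such `r` the needle lies inside `(0, T]`, so its full length `r` is integrated.
  have h1 : ∀ᶠ r in 𝓝[>] (0 : ℝ), r < min τ (T - τ) :=
    mem_nhdsWithin_of_mem_nhds (gt_mem_nhds (lt_min hτ.1 (sub_pos.2 hτ.2)))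
  filter_upwards [hm, hc (ε / 2) (half_pos hε), h1, self_mem_nhdsWithin] with r hrm hrc hr hr0
  have hr0' : 0 < r := hr0
  have ha := lt_min_iff.1 hr
  have hle : τ - r / 2 ≤ τ + r / 2 := by linarith
  have e : ∫ s in (0 : ℝ)..T, (Icc (τ - r / 2) (τ + r / 2)).indicator (h r) s =
      ∫ s in (τ - r / 2)..(τ + r / 2), h r s := by
    rw [intervalIntegral.integral_of_le (hτ.1.trans hτ.2).le, integral_indicator measurableSet_Icc,
      Measure.restrict_restrict measurableSet_Icc, intervalIntegral.integral_of_le hle,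
      ← integral_Icc_eq_integral_Ioc]
    congr 2
    refine inter_eq_left.2 fun s hs => ⟨?_, ?_⟩
    · linarith [hs.1]
    · linarith [hs.2]
  have hi : IntervalIntegrable (h r) volume (τ - r / 2) (τ + r / 2) := by
    rw [intervalIntegrable_iff_integrableOn_Icc_of_le hle]
    refine Integrable.of_bound (C := |c| + ε / 2) hrm.aestronglyMeasurable ?_
    refine (ae_restrict_iff' measurableSet_Icc).2 (Eventually.of_forall fun s hs => ?_)
    have := hrc s hs
    calc ‖h r s‖ = |c + (h r s - c)| := by rw [Real.norm_eq_abs]; ring_nf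
      _ ≤ |c| + |h r s - c| := abs_add_le _ _
      _ ≤ _ := by gcongr
  have hsub : r⁻¹ * (∫ s in (τ - r / 2)..(τ + r / 2), h r s) - c =
      r⁻¹ * ∫ s in (τ - r / 2)..(τ + r / 2), (h r s - c) := by
    rw [intervalIntegral.integral_sub hi intervalIntegrable_const, intervalIntegral.integral_const]
    have : τ + r / 2 - (τ - r / 2) = r := by ring
    rw [this, smul_eq_mul]
    field_simp
  rw [e, Real.dist_eq, hsub, abs_mul, abs_inv, abs_of_pos hr0', inv_mul_lt_iff₀ hr0',
    ← Real.norm_eq_abs]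
  calc _ ≤ ε / 2 * |τ + r / 2 - (τ - r / 2)| := by
        refine intervalIntegral.norm_integral_le_of_norm_le_const fun s hs => ?_
        rw [uIoc_of_le hle] at hs
        exact hrc s (Ioc_subset_Icc_self hs)
    _ = ε / 2 * r := by
        rw [show τ + r / 2 - (τ - r / 2) = r by ring, abs_of_pos hr0']
    _ < r * ε := by nlinarith

/-! ### Needle variations and the state perturbation they cause -/

/-- Continuity of a family `g`, and a uniform Lipschitz estimate for it on a tube around the curve
`y`. -/
structure RegularAlong {H E : Type*} [NormedAddCommGroup H] [NormedAddCommGroup E]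
    (g : ℝ → H → E) (y : ℝ → H) (δ L : ℝ) : Prop where
  continuous_uncurry : Continuous fun q : ℝ × H => g q.1 q.2
  continuous_curve : Continuous y
  pos : 0 < δ
  nonneg : 0 ≤ L
  lipschitz : ∀ s, ∀ x ∈ Metric.ball (y s) δ, ∀ w ∈ Metric.ball (y s) δ,
    ‖g s x - g s w‖ ≤ L * ‖x - w‖

theorem RegularAlong.norm_sub_le {H E : Type*} [NormedAddCommGroup H] [NormedAddCommGroup E]
    {g : ℝ → H → E} {y : ℝ → H} {δ L : ℝ} (hg : RegularAlong g y δ L) (s : ℝ) {x w : H}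
    (hx : ‖x‖ < δ) (hw : ‖w‖ < δ) : ‖g s (y s + x) - g s (y s + w)‖ ≤ L * ‖x - w‖ := by
  simpa using hg.lipschitz s (y s + x) (by simpa using hx) (y s + w) (by simpa using hw)

section Needle

variable {U : Type*} {u : ℝ → U} {r τ s : ℝ} {v : U}

theorem needle_of_mem (hs : s ∈ Icc (τ - r / 2) (τ + r / 2)) :
    StageProblem.needle u r τ v s = v := if_pos hs

theorem needle_of_notMem (hs : s ∉ Icc (τ - r / 2) (τ + r / 2)) :
    StageProblem.needle u r τ v s = u s := if_neg hs

theorem needle_congr {u' : ℝ → U} (h : u s = u' s) :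
    StageProblem.needle u r τ v s = StageProblem.needle u' r τ v s := by
  simp only [StageProblem.needle, h]

theorem stronglyMeasurable_needle [TopologicalSpace U] (hu : StronglyMeasurable u) :
    StronglyMeasurable (StageProblem.needle u r τ v) := by
  classical
  have : StageProblem.needle u r τ v = (Icc (τ - r / 2) (τ + r / 2)).piecewise (fun _ => v) u := by
    ext s
    simp only [StageProblem.needle, Set.piecewise]
  rw [this]
  exact stronglyMeasurable_const.piecewise measurableSet_Icc hu

theorem norm_needle_le [NormedAddCommGroup U] {B : ℝ} (hu : ∀ s, ‖u s‖ ≤ B) (s : ℝ) :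
    ‖StageProblem.needle u r τ v s‖ ≤ max B ‖v‖ := by
  by_cases hs : s ∈ Icc (τ - r / 2) (τ + r / 2)
  · rw [needle_of_mem hs]; exact le_max_right _ _
  · rw [needle_of_notMem hs]; exact (hu s).trans (le_max_left _ _)

theorem norm_needle_sub_le [NormedAddCommGroup U] {B : ℝ} (hu : ∀ s, ‖u s‖ ≤ B) (s : ℝ) :
    ‖StageProblem.needle u r τ v s - u s‖ ≤
      (Icc (τ - r / 2) (τ + r / 2)).indicator (fun _ => ‖v‖ + B) s := by
  by_cases hs : s ∈ Icc (τ - r / 2) (τ + r / 2)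
  · rw [needle_of_mem hs, indicator_of_mem hs]
    exact (_root_.norm_sub_le _ _).trans (add_le_add le_rfl (hu s))
  · rw [needle_of_notMem hs, indicator_of_notMem hs, sub_self, norm_zero]

theorem integral_indicator_needle_le {c t : ℝ} (hc : 0 ≤ c) (hr : 0 ≤ r) (ht : 0 ≤ t) :
    ∫ s in (0 : ℝ)..t, (Icc (τ - r / 2) (τ + r / 2)).indicator (fun _ => c) s ≤ c * r := by
  have hi : Integrable ((Icc (τ - r / 2) (τ + r / 2)).indicator fun _ => c) volume :=
    (integrable_indicator_iff measurableSet_Icc).2 (integrableOn_const (by simp))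
  rw [intervalIntegral.integral_of_le ht]
  refine (setIntegral_le_integral hi (Eventually.of_forall fun s => ?_)).trans ?_
  · exact indicator_nonneg (fun _ _ => hc) s
  · rw [integral_indicator measurableSet_Icc, setIntegral_const, Measure.real, Real.volume_Icc,
      show τ + r / 2 - (τ - r / 2) = r by ring, ENNReal.toReal_ofReal hr, smul_eq_mul, mul_comm]

end Needle

section Perturbation

variable {H U : Type*} [NormedAddCommGroup H] [NormedSpace ℝ H]
  [NormedAddCommGroup U] [NormedSpace ℝ U] {K : ℝ → H →L[ℝ] H} {M : ℝ}
  {f : ℝ → H → U →L[ℝ] H} {y : ℝ → H} {u : ℝ → U} {δ L F B T : ℝ}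

/-- The change of the right-hand side caused by a needle variation and a state perturbation. -/
noncomputable def needleForcing (f : ℝ → H → U →L[ℝ] H) (y : ℝ → H) (u : ℝ → U) (r τ : ℝ) (v : U)
    (s : ℝ) (x : H) : H :=
  f s (y s + x) (StageProblem.needle u r τ v s) - f s (y s) (u s)

theorem stronglyMeasurable_needleForcing (hf : RegularAlong f y δ L) (hu : Continuous u) {z : ℝ → H}
    (hz : Continuous z) (r τ : ℝ) (v : U) :
    StronglyMeasurable fun s => needleForcing f y u r τ v s (z s) := by
  have hfz : Continuous fun s => f s (y s + z s) :=
    hf.continuous_uncurry.comp (continuous_id.prodMk (hf.continuous_curve.add hz))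
  have hfy : Continuous fun s => f s (y s) :=
    hf.continuous_uncurry.comp (continuous_id.prodMk hf.continuous_curve)
  have h1 : StronglyMeasurable fun s => f s (y s + z s) (StageProblem.needle u r τ v s) :=
    (continuous_fst.clm_apply continuous_snd).comp_stronglyMeasurable
      (hfz.stronglyMeasurable.prodMk (stronglyMeasurable_needle hu.stronglyMeasurable))
  exact h1.sub (hfy.clm_apply hu).stronglyMeasurable

/-- The forcing splits into the change of `f` due to the state, applied to the needle control, and
`f` on the unperturbed curve applied to the change of control. The latter lives on the needle and is
the source of the factor `r`. -/
theorem norm_needleForcing_le (hf : RegularAlong f y δ L) (hF : ∀ s, ‖f s (y s)‖ ≤ F)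
    (hB : ∀ s, ‖u s‖ ≤ B) (r τ : ℝ) (v : U) (s : ℝ) {x : H} (hx : ‖x‖ < δ) :
    ‖needleForcing f y u r τ v s x‖ ≤ L * max B ‖v‖ * ‖x‖ +
      (Icc (τ - r / 2) (τ + r / 2)).indicator (fun _ => F * (‖v‖ + B)) s := by
  have e : needleForcing f y u r τ v s x =
      (f s (y s + x) - f s (y s + 0)) (StageProblem.needle u r τ v s) +
        f s (y s) (StageProblem.needle u r τ v s - u s) := by
    simp [needleForcing]
  have hF0 : 0 ≤ F := (norm_nonneg _).trans (hF 0)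
  have h1 := hf.norm_sub_le s hx (w := 0) (by simpa using hf.pos)
  rw [sub_zero] at h1
  have h2 : (Icc (τ - r / 2) (τ + r / 2)).indicator (fun _ => F * (‖v‖ + B)) s =
      F * (Icc (τ - r / 2) (τ + r / 2)).indicator (fun _ => ‖v‖ + B) s := by
    by_cases hs : s ∈ Icc (τ - r / 2) (τ + r / 2) <;> simp [hs]
  rw [e, h2]
  refine (norm_add_le _ _).trans (add_le_add ?_ ?_)
  · refine (ContinuousLinearMap.le_opNorm _ _).trans ?_
    calc _ ≤ L * ‖x‖ * max B ‖v‖ :=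
          mul_le_mul h1 (norm_needle_le hB s) (norm_nonneg _)
            (mul_nonneg hf.nonneg (norm_nonneg _))
      _ = _ := by ring
  · exact (ContinuousLinearMap.le_opNorm _ _).trans
      (mul_le_mul (hF s) (norm_needle_sub_le hB s) (norm_nonneg _) hF0)

/-- Needle variations of length `r` perturb the state by `O(r)`. -/
theorem exists_needle_perturbation [CompleteSpace H]
    (hK : Continuous fun q : ℝ × H => K q.1 q.2)
    (hM : ∀ r, ‖K r‖ ≤ M) (hT : 0 ≤ T) (hf : RegularAlong f y δ L) (hF : ∀ s, ‖f s (y s)‖ ≤ F)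
    (hu : Continuous u) (hB : ∀ s, ‖u s‖ ≤ B) (τ : ℝ) (v : U) :
    ∃ C : ℝ, ∃ z : ℝ → ℝ → H, ∀ᶠ r in 𝓝[>] (0 : ℝ), Continuous (z r) ∧ (∀ s, ‖z r s‖ ≤ C * r) ∧
      ∀ t ∈ Icc 0 T, z r t =
        ∫ s in (0 : ℝ)..t, K (t - s) (needleForcing f y u r τ v s (z r s)) := by
  have hM0 : 0 ≤ M := (norm_nonneg _).trans (hM 0)
  have hF0 : 0 ≤ F := (norm_nonneg _).trans (hF 0)
  have hB0 : 0 ≤ B := (norm_nonneg _).trans (hB 0)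
  have hL := hf.nonneg
  have hδ2 : 0 < δ / 2 := half_pos hf.pos
  set V := max B ‖v‖ with hV
  have hV0 : 0 ≤ V := hB0.trans (le_max_left _ _)
  -- The Grönwall constant: initial term `M * (F * (‖v‖ + B)) * r` from the needle, rate `M * (L *
  -- V)` from the state dependence.
  set C := M * (F * (‖v‖ + B)) * Real.exp (M * (L * V) * T) with hC
  -- Truncation makes the forcing bounded and globally Lipschitz, although `f` is controlled only in
  -- a tube about `y`.
  set ρ : H → H := radialRetraction (δ / 2) with hρ
  have hρδ : ∀ x, ‖ρ x‖ < δ := fun x =>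
    (norm_radialRetraction_le hδ2 x).trans_lt (half_lt_self hf.pos)
  suffices h : ∀ᶠ r in 𝓝[>] (0 : ℝ), ∃ z : ℝ → H, Continuous z ∧ (∀ s, ‖z s‖ ≤ C * r) ∧
      ∀ t ∈ Icc 0 T, z t = ∫ s in (0 : ℝ)..t, K (t - s) (needleForcing f y u r τ v s (z s)) from
    ⟨C, Filter.skolem.1 h⟩
  -- For such `r` the a priori bound keeps the solution in the ball where `ρ` is the identity, so
  -- the truncated equation is the original one.
  filter_upwards [eventually_const_mul_lt (C := C) hδ2, self_mem_nhdsWithin] with r hrδ hr0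
  have hr0' : 0 < r := hr0
  obtain ⟨ζ, hζc, hζ⟩ := exists_volterra_solution (G := fun s x => needleForcing f y u r τ v s (ρ x))
    (C := L * V * δ + F * (‖v‖ + B)) (L := 2 * (L * V)) hK hM hT (by positivity)
    (fun z hz => stronglyMeasurable_needleForcing hf hu
      ((continuous_radialRetraction hδ2).comp hz) r τ v)
    (fun s x => by
      refine (norm_needleForcing_le hf hF hB r τ v s (hρδ x)).trans (add_le_add ?_ ?_)
      · exact mul_le_mul_of_nonneg_left (hρδ x).le (by positivity)
      · exact indicator_le_self' (fun _ _ => by positivity) s)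
    (fun s x x' => by
      have e : needleForcing f y u r τ v s (ρ x) - needleForcing f y u r τ v s (ρ x') =
          (f s (y s + ρ x) - f s (y s + ρ x')) (StageProblem.needle u r τ v s) := by
        simp [needleForcing]
      rw [e]
      calc _ ≤ _ := ContinuousLinearMap.le_opNorm _ _
        _ ≤ L * (2 * ‖x - x'‖) * V := by
            refine mul_le_mul ?_ (norm_needle_le hB s) (norm_nonneg _) (by positivity)
            refine (hf.norm_sub_le s (hρδ x) (hρδ x')).trans ?_
            exact mul_le_mul_of_nonneg_left (norm_radialRetraction_sub_le hδ2 x x') hL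
        _ = _ := by ring)
  have hζb : ∀ t ∈ Icc 0 T, ‖ζ t‖ ≤ C * r := by
    have := gronwall_integral (φ := fun t => ‖ζ t‖) (T := T) (a := M * (F * (‖v‖ + B) * r))
      (k := M * (L * V)) hζc.norm.continuousOn (by positivity) (by positivity) fun t ht => ?_
    · intro t ht
      refine (this t ht).trans (le_of_eq ?_)
      rw [hC]; ring
    · have hi1 : IntervalIntegrable (fun s => M * (L * V) * ‖ζ s‖) volume 0 t :=
        Continuous.intervalIntegrable (by fun_prop) _ _
      have hi2 : IntervalIntegrable (fun s => M * (Icc (τ - r / 2) (τ + r / 2)).indicator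
          (fun _ => F * (‖v‖ + B)) s) volume 0 t := by
        refine IntervalIntegrable.const_mul ?_ _
        rw [intervalIntegrable_iff]
        exact ((integrable_indicator_iff measurableSet_Icc).2
          (integrableOn_const (by simp))).integrableOn
      rw [hζ t ht]
      calc _ ≤ ∫ s in (0 : ℝ)..t, (M * (L * V) * ‖ζ s‖ + M *
            (Icc (τ - r / 2) (τ + r / 2)).indicator (fun _ => F * (‖v‖ + B)) s) := by
            refine intervalIntegral.norm_integral_le_of_norm_le ht.1
              (Eventually.of_forall fun s _ => ?_) (hi1.add hi2)
            refine (ContinuousLinearMap.le_of_opNorm_le _ (hM _) _).trans ?_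
            rw [mul_assoc, ← mul_add]
            refine mul_le_mul_of_nonneg_left ?_ hM0
            refine (norm_needleForcing_le hf hF hB r τ v s (hρδ _)).trans ?_
            have := norm_radialRetraction_le_norm hδ2 (ζ s)
            gcongr
        _ ≤ M * (F * (‖v‖ + B) * r) + M * (L * V) * ∫ s in (0 : ℝ)..t, ‖ζ s‖ := by
            rw [intervalIntegral.integral_add hi1 hi2, intervalIntegral.integral_const_mul,
              intervalIntegral.integral_const_mul, add_comm]
            gcongr
            exact integral_indicator_needle_le (by positivity) hr0'.le ht.1
  -- Grönwall bounds `ζ` only on `[0, T]`; clamping time extends the bound to the whole line.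
  refine ⟨fun t => ζ (timeClamp T t), hζc.comp (continuous_timeClamp T),
    fun s => hζb _ (timeClamp_mem hT s), fun t ht => ?_⟩
  simp only [timeClamp_of_mem ht]
  rw [hζ t ht]
  refine intervalIntegral_congr_of_Icc ht.1 fun s hs => ?_
  have hs' : s ∈ Icc 0 T := ⟨hs.1, hs.2.trans ht.2⟩
  simp only [timeClamp_of_mem hs']
  rw [hρ, radialRetraction_of_norm_le hδ2 ((hζb s hs').trans hrδ.le)]

end Perturbation

/-! ### First variation of the cost via the adjoint state -/

section FirstVariation

variable {H U : Type*} [NormedAddCommGroup H] [NormedSpace ℝ H]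
  [NormedAddCommGroup U] [NormedSpace ℝ U] {K : ℝ → H →L[ℝ] H} {M : ℝ}
  {f : ℝ → H → U →L[ℝ] H} {y : ℝ → H} {u : ℝ → U} {δ L F B T : ℝ}

theorem RegularAlong.apply_control (hf : RegularAlong f y δ L) (hu : Continuous u)
    (hB : ∀ s, ‖u s‖ ≤ B) : RegularAlong (fun s x => f s x (u s)) y δ (L * B) where
  continuous_uncurry := hf.continuous_uncurry.clm_apply (hu.comp continuous_fst)
  continuous_curve := hf.continuous_curve
  pos := hf.pos
  nonneg := mul_nonneg hf.nonneg ((norm_nonneg _).trans (hB 0))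
  lipschitz s x hx w hw := by
    rw [← sub_apply]
    calc _ ≤ _ := ContinuousLinearMap.le_opNorm _ _
      _ ≤ L * ‖x - w‖ * B := mul_le_mul (hf.lipschitz s x hx w hw) (hB s) (norm_nonneg _)
          (mul_nonneg hf.nonneg (norm_nonneg _))
      _ = _ := by ring

/-- The coefficient of the state perturbation in the adjoint equation. -/
noncomputable def adjointSource (f : ℝ → H → U →L[ℝ] H) (y : ℝ → H) (u : ℝ → U) (l : H → ℝ)
    (p : ℝ → StrongDual ℝ H) (s : ℝ) : StrongDual ℝ H :=
  (p s).comp (fderiv ℝ (fun x => f s x (u s)) (y s)) + fderiv ℝ l (y s)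

variable {l m : H → ℝ} {p : ℝ → StrongDual ℝ H} {A δ' L' : ℝ}

theorem norm_adjointSource_le (hf : RegularAlong f y δ L) (hu : Continuous u)
    (hB : ∀ s, ‖u s‖ ≤ B) (hl : RegularAlong (fun _ => l) y δ' L') (hA : ∀ s, ‖p s‖ ≤ A) (s : ℝ) :
    ‖adjointSource f y u l p s‖ ≤ A * (L * B) + L' := by
  have hg := hf.apply_control hu hB
  refine (norm_add_le _ _).trans (add_le_add ?_ ?_)
  · refine (ContinuousLinearMap.opNorm_comp_le _ _).trans ?_
    exact mul_le_mul (hA s) (norm_fderiv_le_of_tube hg.pos hg.nonneg hg.lipschitz s) (norm_nonneg _)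
      ((norm_nonneg _).trans (hA s))
  · exact norm_fderiv_le_of_tube (g := fun _ => l) hl.pos hl.nonneg hl.lipschitz s

theorem stronglyMeasurable_adjointSource_apply (hf : RegularAlong f y δ L)
    (hfd : ∀ s, DifferentiableAt ℝ (f s) (y s)) (hu : Continuous u) (hB : ∀ s, ‖u s‖ ≤ B)
    (hl : RegularAlong (fun _ => l) y δ' L') (hld : Differentiable ℝ l) (hp : Continuous p)
    {α : Type*} [MeasurableSpace α] {a : α → ℝ} {k : α → H} (ha : StronglyMeasurable a)
    (hk : StronglyMeasurable k) :
    StronglyMeasurable fun x => adjointSource f y u l p (a x) (k x) := by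
  have hg := hf.apply_control hu hB
  have h1 : StronglyMeasurable fun x =>
      fderiv ℝ (fun w => f (a x) w (u (a x))) (y (a x)) (k x) :=
    stronglyMeasurable_fderiv_apply_along (g := fun s x => f s x (u s)) hg.continuous_uncurry
      hg.continuous_curve (fun s => (hfd s).clm_apply (differentiableAt_const _)) ha hk
  have h2 : StronglyMeasurable fun x => fderiv ℝ l (y (a x)) (k x) :=
    stronglyMeasurable_fderiv_apply_along (g := fun _ => l) hl.continuous_uncurry
      hl.continuous_curve (fun s => hld _) ha hk
  exact ((continuous_fst.clm_apply continuous_snd).comp_stronglyMeasurable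
    ((hp.comp_stronglyMeasurable ha).prodMk h1)).add h2

/-- The first-order expansion of the cost along a needle variation, in terms of the adjoint
state. -/
theorem needle_cost_expansion [CompleteSpace H] (hK : Continuous fun q : ℝ × H => K q.1 q.2)
    (hM : ∀ r, ‖K r‖ ≤ M) (hT : 0 ≤ T) (hf : RegularAlong f y δ L) (hF : ∀ s, ‖f s (y s)‖ ≤ F)
    (hfd : ∀ s, DifferentiableAt ℝ (f s) (y s)) (hu : Continuous u) (hB : ∀ s, ‖u s‖ ≤ B)
    (hl : RegularAlong (fun _ => l) y δ' L') (hld : Differentiable ℝ l)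
    (hpc : Continuous p) (hA : ∀ s, ‖p s‖ ≤ A)
    (hp : ∀ t ∈ Icc 0 T,
      IntervalIntegrable (fun s => (adjointSource f y u l p s).comp (K (s - t))) volume t T ∧
      p t = (fderiv ℝ m (y T)).comp (K (T - t)) +
        ∫ s in t..T, (adjointSource f y u l p s).comp (K (s - t)))
    {r τ : ℝ} {v : U} {z : ℝ → H} (hz : Continuous z) (hzδ : ∀ s, ‖z s‖ < δ)
    (hzδ' : ∀ s, ‖z s‖ < δ') (hzeq : ∀ t ∈ Icc 0 T, z t =
      ∫ s in (0 : ℝ)..t, K (t - s) (needleForcing f y u r τ v s (z s))) :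
    ((∫ s in (0 : ℝ)..T, l (y s + z s)) + m (y T + z T)) - ((∫ s in (0 : ℝ)..T, l (y s)) + m (y T)) =
      (∫ s in (0 : ℝ)..T, linRem (fun _ => l) y s (z s)) + linRem (fun _ => m) y T (z T) +
      (∫ s in (0 : ℝ)..T, p s (linRem (fun s x => f s x (u s)) y s (z s))) +
      ∫ s in (0 : ℝ)..T, (Icc (τ - r / 2) (τ + r / 2)).indicator
        (fun s => p s (f s (y s + z s) (v - u s))) s := by
  have hA0 : 0 ≤ A := (norm_nonneg _).trans (hA 0)
  have hF0 : 0 ≤ F := (norm_nonneg _).trans (hF 0)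
  have hB0 : 0 ≤ B := (norm_nonneg _).trans (hB 0)
  have hL := hf.nonneg
  have hL' := hl.nonneg
  have hg := hf.apply_control hu hB
  have hgd : ∀ s, DifferentiableAt ℝ (fun x => f s x (u s)) (y s) := fun s =>
    (hfd s).clm_apply (differentiableAt_const _)
  set q := adjointSource f y u l p with hq
  set w : ℝ → H := fun s => needleForcing f y u r τ v s (z s) with hw
  have hwm : StronglyMeasurable w := stronglyMeasurable_needleForcing hf hu hz r τ v
  have hwb : ∀ s, ‖w s‖ ≤ L * max B ‖v‖ * δ + F * (‖v‖ + B) := fun s => by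
    refine (norm_needleForcing_le hf hF hB r τ v s (hzδ s)).trans (add_le_add ?_ ?_)
    · exact mul_le_mul_of_nonneg_left (hzδ s).le (mul_nonneg hL (hB0.trans (le_max_left _ _)))
    · exact indicator_le_self' (fun _ _ => by positivity) s
  -- Duality is applied to the full nonlinear forcing `w`, so the convolutions on the right are
  -- values of `z` itself and the identity is exact.
  have hdual := integral_volterra_duality hK hM hT hwm hwb
    (norm_adjointSource_le hf hu hB hl hA)
    (stronglyMeasurable_adjointSource_apply hf hfd hu hB hl hld hpc
      measurable_fst.stronglyMeasurable (stronglyMeasurable_kernel_apply hK hwm)) hp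
  rw [← hzeq T (right_mem_Icc.2 hT),
    intervalIntegral_congr_of_Icc hT fun s hs => (congrArg (q s) (hzeq s hs)).symm] at hdual
  have hfz : Continuous fun s => f s (y s + z s) :=
    hf.continuous_uncurry.comp (continuous_id.prodMk (hf.continuous_curve.add hz))
  have hfzb : ∀ s, ‖f s (y s + z s)‖ ≤ F + L * δ := fun s => by
    have h1 := hf.norm_sub_le s (hzδ s) (w := 0) (by simpa using hf.pos)
    rw [sub_zero, add_zero] at h1
    calc ‖f s (y s + z s)‖ = ‖f s (y s) + (f s (y s + z s) - f s (y s))‖ := by simp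
      _ ≤ ‖f s (y s)‖ + ‖f s (y s + z s) - f s (y s)‖ := norm_add_le _ _
      _ ≤ F + L * δ := add_le_add (hF s) (h1.trans (mul_le_mul_of_nonneg_left (hzδ s).le hL))
  have happ : ∀ {b : ℝ → H}, StronglyMeasurable b → StronglyMeasurable fun s => p s (b s) :=
    fun hb => (continuous_fst.clm_apply continuous_snd).comp_stronglyMeasurable
      (hpc.stronglyMeasurable.prodMk hb)
  have happb : ∀ {b : H} {c : ℝ} (s : ℝ), ‖b‖ ≤ c → ‖p s b‖ ≤ A * c := fun s hb =>
    ((p s).le_of_opNorm_le (hA s) _).trans (mul_le_mul_of_nonneg_left hb hA0)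
  have i1 : IntervalIntegrable (fun s => p s (linRem (fun s x => f s x (u s)) y s (z s)))
      volume 0 T :=
    intervalIntegrable_of_stronglyMeasurable_of_bound
      (happ (stronglyMeasurable_linRem hg.continuous_uncurry hg.continuous_curve hgd hz))
      (fun s => happb s ((norm_linRem_le hg.pos hg.nonneg hg.lipschitz (hzδ s)).trans
        (mul_le_mul_of_nonneg_left (hzδ s).le (mul_nonneg zero_le_two hg.nonneg)))) _ _
  have i2 : IntervalIntegrable (fun s => q s (z s)) volume 0 T :=
    intervalIntegrable_of_stronglyMeasurable_of_bound
      (stronglyMeasurable_adjointSource_apply hf hfd hu hB hl hld hpc stronglyMeasurable_id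
        hz.stronglyMeasurable)
      (fun s => ((q s).le_of_opNorm_le (norm_adjointSource_le hf hu hB hl hA s) _).trans
        (mul_le_mul_of_nonneg_left (hzδ s).le
          (add_nonneg (mul_nonneg hA0 (mul_nonneg hL hB0)) hL'))) _ _
  have i3 : IntervalIntegrable (fun s => (Icc (τ - r / 2) (τ + r / 2)).indicator
      (fun s => p s (f s (y s + z s) (v - u s))) s) volume 0 T := by
    refine intervalIntegrable_of_stronglyMeasurable_of_bound
      (C := A * ((F + L * δ) * (‖v‖ + B))) ?_ (fun s => ?_) _ _
    · exact (happ (hfz.clm_apply (continuous_const.sub hu)).stronglyMeasurable).indicator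
        measurableSet_Icc
    · refine (norm_indicator_le_norm_self _ _).trans (happb s ?_)
      refine (ContinuousLinearMap.le_opNorm _ _).trans ?_
      exact mul_le_mul (hfzb s) ((norm_sub_le _ _).trans (add_le_add le_rfl (hB s)))
        (norm_nonneg _) ((norm_nonneg _).trans (hfzb s))
  have i4 : IntervalIntegrable (fun s => linRem (fun _ => l) y s (z s)) volume 0 T :=
    intervalIntegrable_of_stronglyMeasurable_of_bound
      (stronglyMeasurable_linRem (g := fun _ => l) hl.continuous_uncurry hl.continuous_curve
        (fun s => hld _) hz)
      (fun s => (norm_linRem_le (g := fun _ => l) hl.pos hl.nonneg hl.lipschitz (hzδ' s)).trans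
        (mul_le_mul_of_nonneg_left (hzδ' s).le (mul_nonneg zero_le_two hl.nonneg))) _ _
  have i5 : IntervalIntegrable (fun s => fderiv ℝ l (y s) (z s)) volume 0 T :=
    intervalIntegrable_of_stronglyMeasurable_of_bound
      (stronglyMeasurable_fderiv_apply_along (g := fun _ => l) hl.continuous_uncurry
        hl.continuous_curve (fun s => hld _) stronglyMeasurable_id hz.stronglyMeasurable)
      (fun s => (ContinuousLinearMap.le_of_opNorm_le _
        (norm_fderiv_le_of_tube (g := fun _ => l) hl.pos hl.nonneg hl.lipschitz s) _).trans
        (mul_le_mul_of_nonneg_left (hzδ' s).le hl.nonneg)) _ _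
  have hy := hf.continuous_curve
  have hlc := hld.continuous
  have e1 : (∫ s in (0 : ℝ)..T, l (y s + z s)) - ∫ s in (0 : ℝ)..T, l (y s) =
      (∫ s in (0 : ℝ)..T, linRem (fun _ => l) y s (z s)) +
        ∫ s in (0 : ℝ)..T, fderiv ℝ l (y s) (z s) := by
    have i6 : IntervalIntegrable (fun s => l (y s + z s)) volume 0 T :=
      (hlc.comp (hy.add hz)).intervalIntegrable _ _
    have i7 : IntervalIntegrable (fun s => l (y s)) volume 0 T :=
      (hlc.comp hy).intervalIntegrable _ _
    rw [← intervalIntegral.integral_sub i6 i7, ← intervalIntegral.integral_add i4 i5]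
    simp [linRem]
  -- The forcing is the linearization remainder of `f u`, plus its derivative along `z`, plus `f(s,
  -- y + z) (v - u)` on the needle. Under `p`, the derivative term is `q z` without its `l` part;
  -- the `q z` integral then cancels in `hdual`.
  have e2 : ∫ s in (0 : ℝ)..T, p s (w s) =
      (∫ s in (0 : ℝ)..T, p s (linRem (fun s x => f s x (u s)) y s (z s))) +
      ((∫ s in (0 : ℝ)..T, q s (z s)) - ∫ s in (0 : ℝ)..T, fderiv ℝ l (y s) (z s)) +
      ∫ s in (0 : ℝ)..T, (Icc (τ - r / 2) (τ + r / 2)).indicator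
        (fun s => p s (f s (y s + z s) (v - u s))) s := by
    rw [← intervalIntegral.integral_sub i2 i5, ← intervalIntegral.integral_add i1 (i2.sub i5),
      ← intervalIntegral.integral_add (i1.add (i2.sub i5)) i3]
    refine intervalIntegral_congr_of_Icc hT fun s _ => ?_
    by_cases hs : s ∈ Icc (τ - r / 2) (τ + r / 2)
    · simp only [hw, hq, needleForcing, adjointSource, linRem, needle_of_mem hs,
        indicator_of_mem hs, add_apply, ContinuousLinearMap.comp_apply, map_sub]
      ring
    · simp only [hw, hq, needleForcing, adjointSource, linRem, needle_of_notMem hs,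
        indicator_of_notMem hs, add_apply, ContinuousLinearMap.comp_apply,
        map_sub]
      ring
  have e3 : linRem (fun _ => m) y T (z T) = m (y T + z T) - m (y T) - fderiv ℝ m (y T) (z T) := rfl
  rw [e2] at hdual
  rw [e3]
  linarith

/-- The first variation of the cost along needle variations. -/
theorem tendsto_needle_cost [CompleteSpace H] (hK : Continuous fun q : ℝ × H => K q.1 q.2)
    (hM : ∀ r, ‖K r‖ ≤ M) (hf : RegularAlong f y δ L) (hF : ∀ s, ‖f s (y s)‖ ≤ F)
    (hfd : ∀ s, DifferentiableAt ℝ (f s) (y s)) (hu : Continuous u) (hB : ∀ s, ‖u s‖ ≤ B)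
    (hl : RegularAlong (fun _ => l) y δ' L') (hld : Differentiable ℝ l)
    (hm : DifferentiableAt ℝ m (y T)) (hpc : Continuous p) (hA : ∀ s, ‖p s‖ ≤ A)
    (hp : ∀ t ∈ Icc 0 T,
      IntervalIntegrable (fun s => (adjointSource f y u l p s).comp (K (s - t))) volume t T ∧
      p t = (fderiv ℝ m (y T)).comp (K (T - t)) +
        ∫ s in t..T, (adjointSource f y u l p s).comp (K (s - t)))
    {τ : ℝ} (hτ : τ ∈ Ioo 0 T) {v : U} {z : ℝ → ℝ → H} {C : ℝ}
    (hz : ∀ᶠ r in 𝓝[>] (0 : ℝ), Continuous (z r) ∧ (∀ s, ‖z r s‖ ≤ C * r) ∧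
      ∀ t ∈ Icc 0 T, z r t =
        ∫ s in (0 : ℝ)..t, K (t - s) (needleForcing f y u r τ v s (z r s))) :
    Tendsto (fun r => r⁻¹ * (((∫ s in (0 : ℝ)..T, l (y s + z r s)) + m (y T + z r T)) -
        ((∫ s in (0 : ℝ)..T, l (y s)) + m (y T)))) (𝓝[>] 0)
      (𝓝 (p τ (f τ (y τ) (v - u τ)))) := by
  have hT : 0 ≤ T := (hτ.1.trans hτ.2).le
  have hA0 : 0 ≤ A := (norm_nonneg _).trans (hA 0)
  have hg := hf.apply_control hu hB
  have hgd : ∀ s, DifferentiableAt ℝ (fun x => f s x (u s)) (y s) := fun s =>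
    (hfd s).clm_apply (differentiableAt_const _)
  have hzc := hz.mono fun r h => h.1
  have hzb := hz.mono fun r h => h.2.1
  have t1 : Tendsto (fun r => r⁻¹ * ∫ s in (0 : ℝ)..T, linRem (fun _ => l) y s (z r s))
      (𝓝[>] 0) (𝓝 0) := by
    refine squeeze_zero_norm' ?_ (tendsto_integral_linRem (g := fun _ => l) hl.continuous_uncurry
      hl.continuous_curve (fun s => hld _) hl.pos hl.nonneg hl.lipschitz hzc hzb T)
    filter_upwards [self_mem_nhdsWithin] with r hr
    have hr0 : (0 : ℝ) < r := hr
    rw [norm_mul, norm_inv, Real.norm_of_nonneg hr0.le]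
    gcongr
    exact intervalIntegral.norm_integral_le_integral_norm hT
  have t2 : Tendsto (fun r => r⁻¹ * linRem (fun _ => m) y T (z r T)) (𝓝[>] 0) (𝓝 0) :=
    tendsto_inv_smul_of_isLittleO (isLittleO_linRem (g := fun _ => m) hm)
      (hzb.mono fun r h => h T)
  have t3 : Tendsto (fun r => r⁻¹ * ∫ s in (0 : ℝ)..T,
      p s (linRem (fun s x => f s x (u s)) y s (z r s))) (𝓝[>] 0) (𝓝 0) := by
    have h0 := (tendsto_integral_linRem hg.continuous_uncurry hg.continuous_curve hgd hg.pos
      hg.nonneg hg.lipschitz hzc hzb T).const_mul A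
    rw [mul_zero] at h0
    refine squeeze_zero_norm' ?_ h0
    filter_upwards [self_mem_nhdsWithin, hzc, hzb, eventually_const_mul_lt (C := C) hg.pos]
      with r hr hrc hrb hrδ
    have hr0 : (0 : ℝ) < r := hr
    rw [norm_mul, norm_inv, Real.norm_of_nonneg hr0.le, mul_left_comm]
    refine mul_le_mul_of_nonneg_left ?_ (by positivity)
    rw [← intervalIntegral.integral_const_mul]
    refine intervalIntegral.norm_integral_le_of_norm_le hT
      (Eventually.of_forall fun s _ => (p s).le_of_opNorm_le (hA s) _) ?_
    refine IntervalIntegrable.const_mul (intervalIntegrable_of_stronglyMeasurable_of_bound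
      (stronglyMeasurable_linRem hg.continuous_uncurry hg.continuous_curve hgd hrc).norm
      (C := 2 * (L * B) * δ) (fun s => ?_) _ _) _
    rw [norm_norm]
    have hs := (hrb s).trans_lt hrδ
    exact (norm_linRem_le hg.pos hg.nonneg hg.lipschitz hs).trans
      (mul_le_mul_of_nonneg_left hs.le (mul_nonneg zero_le_two hg.nonneg))
  have t4 : Tendsto (fun r => r⁻¹ * ∫ s in (0 : ℝ)..T, (Icc (τ - r / 2) (τ + r / 2)).indicator
      (fun s => p s (f s (y s + z r s) (v - u s))) s) (𝓝[>] 0)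
      (𝓝 (p τ (f τ (y τ) (v - u τ)))) := by
    -- Joint continuity at `(τ, 0)` gives the uniform closeness on the needle, where both `s - τ`
    -- and `z` are `O(r)`.
    have hκ : Continuous fun x : ℝ × H => p x.1 (f x.1 (y x.1 + x.2) (v - u x.1)) :=
      (hpc.comp continuous_fst).clm_apply ((hf.continuous_uncurry.comp (continuous_fst.prodMk
        ((hf.continuous_curve.comp continuous_fst).add continuous_snd))).clm_apply
        (continuous_const.sub (hu.comp continuous_fst)))
    refine tendsto_needle_average hτ ?_ fun ε hε => ?_
    · filter_upwards [hzc] with r hr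
      exact (hκ.comp (continuous_id.prodMk hr)).stronglyMeasurable
    · obtain ⟨η, hη, h⟩ := Metric.continuousAt_iff.1 (hκ.continuousAt (x := (τ, 0))) ε hε
      filter_upwards [self_mem_nhdsWithin, hzb, eventually_const_mul_lt (C := C) hη,
        eventually_const_mul_lt (C := 1) hη] with r hr hrb hrη hrη' s hs
      have hr0 : (0 : ℝ) < r := hr
      have hd : dist (s, z r s) (τ, (0 : H)) < η := by
        rw [Prod.dist_eq]
        refine max_lt ?_ ?_
        · simp only [Real.dist_eq, abs_lt]
          constructor <;> linarith [hs.1, hs.2]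
        · simpa using (hrb s).trans_lt hrη
      have := h hd
      simp only [Real.dist_eq, add_zero] at this
      exact this.le
  have key := ((t1.add t2).add t3).add t4
  simp only [zero_add] at key
  refine key.congr' ?_
  filter_upwards [hz, eventually_const_mul_lt (C := C) hf.pos,
    eventually_const_mul_lt (C := C) hl.pos] with r hr hrδ hrδ'
  rw [needle_cost_expansion hK hM hT hf hF hfd hu hB hl hld hpc hA hp hr.1
    (fun s => (hr.2.1 s).trans_lt hrδ) (fun s => (hr.2.1 s).trans_lt hrδ') hr.2.2]
  ring

end FirstVariation

/-! ### The regularized least squares problem -/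

section Quadratic

variable {U : Type*} [NormedAddCommGroup U] [InnerProductSpace ℝ U] [CompleteSpace U]

/-- This is Lax–Milgram for the bilinear form `⟨Q w, x⟩`. -/
theorem isInvertible_of_coercive {Q : U →L[ℝ] U} {γ : ℝ} (hγ : 0 < γ)
    (hQ : ∀ w, γ * ‖w‖ ^ 2 ≤ inner ℝ (Q w) w) : Q.IsInvertible := by
  let B : U →L[ℝ] U →L[ℝ] ℝ := (innerSL ℝ : U →L[ℝ] U →L[ℝ] ℝ).comp Q
  have hB : IsCoercive B := ⟨γ, hγ, fun w => by
    simpa [B, pow_two, mul_assoc] using hQ w⟩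
  refine ⟨hB.continuousLinearEquivOfBilin, ?_⟩
  ext w
  refine ext_inner_right ℝ fun x => ?_
  exact hB.continuousLinearEquivOfBilin_apply w x

variable {P : U →L[ℝ] ℝ} {R : U →L[ℝ] U} {γ : ℝ}

theorem isInvertible_regularized (hR : IsSelfAdjoint R) (hγ : 0 < γ)
    (hRγ : ∀ w, γ * ‖w‖ ^ 2 ≤ inner ℝ (R w) w) :
    ((ContinuousLinearMap.adjoint P).comp P + ContinuousLinearMap.adjoint R).IsInvertible := by
  refine isInvertible_of_coercive hγ fun w => ?_
  rw [hR.adjoint_eq, add_apply, inner_add_left, ContinuousLinearMap.comp_apply,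
    ContinuousLinearMap.adjoint_inner_left]
  have : 0 ≤ inner ℝ (P w) (P w) := real_inner_self_nonneg
  linarith [hRγ w]

/-- The solution of the regularized normal equation for the target value `a`. -/
theorem regularized_normal_equation (hR : IsSelfAdjoint R) (hγ : 0 < γ)
    (hRγ : ∀ w, γ * ‖w‖ ^ 2 ≤ inner ℝ (R w) w) {a : ℝ} {w : U}
    (hw : w = ((ContinuousLinearMap.adjoint P).comp P + ContinuousLinearMap.adjoint R).inverse
      (ContinuousLinearMap.adjoint P a)) :
    R w = ContinuousLinearMap.adjoint P (a - P w) := by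
  have h := (isInvertible_regularized (P := P) hR hγ hRγ).self_apply_inverse
    (ContinuousLinearMap.adjoint P a)
  rw [← hw, hR.adjoint_eq, add_apply, ContinuousLinearMap.comp_apply] at h
  rw [map_sub, ← h]
  abel

theorem inner_normal_equation {a : ℝ} {w : U} (hw : R w = ContinuousLinearMap.adjoint P (a - P w))
    (x : U) : inner ℝ (R w) x = (a - P w) * P x := by
  rw [hw, ContinuousLinearMap.adjoint_inner_left]
  simp [mul_comm]

/-- A solution of the normal equation is the unique minimizer of the regularized least squares
functional. -/
theorem forall_le_regularized_iff (hR : IsSelfAdjoint R) (hγ : 0 < γ)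
    (hRγ : ∀ w, γ * ‖w‖ ^ 2 ≤ inner ℝ (R w) w) {a : ℝ} {w : U}
    (hw : R w = ContinuousLinearMap.adjoint P (a - P w)) (v : U) :
    (∀ x, (1 / 2) * (P v - a) ^ 2 + (1 / 2) * inner ℝ v (R v) ≤
      (1 / 2) * (P x - a) ^ 2 + (1 / 2) * inner ℝ x (R x)) ↔ v = w := by
  -- Exact second-order expansion about `w`: the linear terms cancel by the normal equation and the
  -- symmetry of `R`.
  have hsq : ∀ x, (1 / 2) * (P x - a) ^ 2 + (1 / 2) * inner ℝ x (R x) =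
      (1 / 2) * (P w - a) ^ 2 + (1 / 2) * inner ℝ w (R w) + (1 / 2) * (P (x - w)) ^ 2 +
        (1 / 2) * inner ℝ (R (x - w)) (x - w) := by
    intro x
    have hs : inner ℝ (R x) w = inner ℝ (R w) x := by
      rw [real_inner_comm, ← ContinuousLinearMap.adjoint_inner_left, hR.adjoint_eq]
    have h1 := inner_normal_equation hw x
    have h2 := inner_normal_equation hw w
    simp only [map_sub, inner_sub_left, inner_sub_right, hs, h1, h2]
    rw [real_inner_comm, real_inner_comm (R w) w, h2]
    ring
  constructor
  · intro h
    have h1 := h w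
    rw [hsq v] at h1
    have h2 := hRγ (v - w)
    have h3 : γ * ‖v - w‖ ^ 2 ≤ 0 := by nlinarith [sq_nonneg (P (v - w))]
    have h4 : ‖v - w‖ ^ 2 ≤ 0 := nonpos_of_mul_nonpos_right h3 hγ
    exact sub_eq_zero.1 (norm_eq_zero.1 (pow_eq_zero_iff two_ne_zero |>.1
      (le_antisymm h4 (sq_nonneg _))))
  · rintro rfl x
    rw [hsq x]
    have := hRγ (x - v)
    have h0 : 0 ≤ γ * ‖x - v‖ ^ 2 := by positivity
    nlinarith [sq_nonneg (P (x - v))]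

/-- The regularized least squares solution moves in a descent direction if the target decrease is
large enough. -/
theorem regularized_descent (hγ : 0 < γ) (hRγ : ∀ w, γ * ‖w‖ ^ 2 ≤ inner ℝ (R w) w) {u₁ w : U}
    {α : ℝ} (hα : α < 0) (hP : P ≠ 0)
    (hw : R w = ContinuousLinearMap.adjoint P (P u₁ + α - P w))
    (hbig : ‖R‖ ^ 2 * ‖u₁‖ < γ * ‖P‖ * (-α)) : P (w - u₁) < 0 := by
  -- If `g ≥ 0`, then `g - α > 0` and `R w = -(g - α) P* 1`. This bounds `‖w‖` from above by
  -- coercivity and from below by the norm of `R w`.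
  by_contra! hg
  have hPn : 0 < ‖P‖ := norm_pos_iff.2 hP
  set g := P (w - u₁) with hgdef
  have hPw : P w = g + P u₁ := by rw [hgdef, map_sub]; ring
  have hβ : 0 < g - α := by linarith
  have e : P u₁ + α - P w = -(g - α) := by rw [hPw]; ring
  have h1 : γ * ‖w‖ ^ 2 ≤ -(g - α) * P w := by
    rw [← e, ← inner_normal_equation hw w]; exact hRγ w
  have hPw0 : P w ≤ 0 := by
    by_contra! hpos
    nlinarith [sq_nonneg ‖w‖, mul_pos hβ hpos, mul_nonneg hγ.le (sq_nonneg ‖w‖)]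
  have hc : -(P w) ≤ ‖P‖ * ‖u₁‖ := by
    have := (neg_le_abs (P u₁)).trans (P.le_opNorm u₁)
    linarith
  have h2 : ‖R w‖ = ‖P‖ * (g - α) := by
    rw [hw, e]
    have : ContinuousLinearMap.adjoint P (-(g - α)) = (-(g - α)) • ContinuousLinearMap.adjoint P 1 := by
      rw [← map_smul]; simp
    rw [this, norm_smul, norm_neg, Real.norm_of_nonneg hβ.le, mul_comm]
    congr 1
    -- On the scalar line the operator norm of `P*` is the norm of `P* 1`, and taking adjoints is
    -- isometric.
    rw [← (ContinuousLinearMap.adjoint (𝕜 := ℝ) (E := U) (F := ℝ)).norm_map P]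
    refine le_antisymm ((ContinuousLinearMap.le_opNorm _ _).trans (by simp)) ?_
    refine ContinuousLinearMap.opNorm_le_bound _ (norm_nonneg _) fun x => ?_
    have : ContinuousLinearMap.adjoint P x = x • ContinuousLinearMap.adjoint P 1 := by
      rw [← map_smul]; simp
    rw [this, norm_smul, mul_comm]
  have h3 : ‖P‖ * (g - α) ≤ ‖R‖ * ‖w‖ := h2 ▸ R.le_opNorm w
  have h4 : γ * (‖P‖ * (g - α)) ^ 2 ≤ ‖R‖ ^ 2 * ((g - α) * (‖P‖ * ‖u₁‖)) := by
    calc γ * (‖P‖ * (g - α)) ^ 2 ≤ γ * (‖R‖ * ‖w‖) ^ 2 := by gcongr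
      _ = ‖R‖ ^ 2 * (γ * ‖w‖ ^ 2) := by ring
      _ ≤ ‖R‖ ^ 2 * ((g - α) * (‖P‖ * ‖u₁‖)) := by
          refine mul_le_mul_of_nonneg_left ?_ (sq_nonneg _)
          calc _ ≤ _ := h1
            _ = (g - α) * (-(P w)) := by ring
            _ ≤ _ := by gcongr
  have h5 : γ * ‖P‖ * (g - α) ≤ ‖R‖ ^ 2 * ‖u₁‖ := by
    refine le_of_mul_le_mul_left ?_ (mul_pos hPn hβ)
    calc _ = γ * (‖P‖ * (g - α)) ^ 2 := by ring
      _ ≤ _ := h4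
      _ = _ := by ring
  have h6 : γ * ‖P‖ * (-α) ≤ γ * ‖P‖ * (g - α) := by gcongr; linarith
  linarith

end Quadratic

/-! ### Application to the stage problem -/

theorem ContinuousOn.exists_bound_timeClamp {X : Type*} [NormedAddCommGroup X] {g : ℝ → X} {T : ℝ}
    (hT : 0 ≤ T) (hg : ContinuousOn g (Icc 0 T)) : ∃ B, ∀ s, ‖g (timeClamp T s)‖ ≤ B := by
  obtain ⟨B, hB⟩ := isCompact_Icc.exists_bound_of_continuousOn hg
  exact ⟨B, fun s => hB _ (timeClamp_mem hT s)⟩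

namespace StageProblem

variable {H U : Type*} [NormedAddCommGroup H] [InnerProductSpace ℝ H] [CompleteSpace H]
  [NormedAddCommGroup U] [InnerProductSpace ℝ U] [CompleteSpace U] (D : StageProblem H U)

theorem exists_norm_S_le : ∃ M, ∀ r, ‖D.S (timeClamp D.T r)‖ ≤ M :=
  banach_steinhaus fun x => ContinuousOn.exists_bound_timeClamp (g := fun t => D.S t x) D.T_pos.le
    ((D.isC0Semigroup.continuousOn x).mono Icc_subset_Ici_self)

/-- Orbits are continuous and the operators are uniformly bounded on `[0, T]`; together these give
joint continuity without continuity in operator norm. -/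
theorem continuous_S : Continuous fun q : ℝ × H => D.S (timeClamp D.T q.1) q.2 := by
  obtain ⟨M, hM⟩ := D.exists_norm_S_le
  rw [continuous_iff_continuousAt]
  rintro ⟨r, x⟩
  have h1 : Continuous fun s => D.S (timeClamp D.T s) x :=
    ContinuousOn.comp_timeClamp (g := fun t => D.S t x) D.T_pos.le
      ((D.isC0Semigroup.continuousOn x).mono Icc_subset_Ici_self)
  have h2 : Tendsto (fun q : ℝ × H => D.S (timeClamp D.T q.1) (q.2 - x)) (𝓝 (r, x)) (𝓝 0) := by
    refine squeeze_zero_norm (fun q => (D.S _).le_of_opNorm_le (hM q.1) _) ?_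
    have : Continuous fun q : ℝ × H => M * ‖q.2 - x‖ := by fun_prop
    simpa using this.tendsto (r, x)
  have h3 := ((h1.comp continuous_fst).tendsto (r, x)).add h2
  simpa [ContinuousAt] using h3

/-- Continuity in time at a fixed state becomes joint continuity because the local Lipschitz
constant in the state is uniform in nearby times. -/
theorem continuousOn_f :
    ContinuousOn (fun q : ℝ × H => D.f q.1 q.2) (Icc 0 D.T ×ˢ univ) := by
  rintro ⟨t, x⟩ ⟨ht, -⟩
  obtain ⟨ε, hε, L, hL⟩ := D.f_locallyLipschitz t ht x
  have h1 : Tendsto (fun q : ℝ × H => D.f q.1 x) (𝓝[Icc 0 D.T ×ˢ univ] (t, x)) (𝓝 (D.f t x)) :=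
    ((D.f_continuousOn x) t ht).tendsto.comp
      (tendsto_nhdsWithin_of_tendsto_nhds_of_eventually_within _
        (continuous_fst.tendsto (t, x) |>.mono_left nhdsWithin_le_nhds)
        (eventually_nhdsWithin_of_forall fun q hq => hq.1))
  have h2 : Tendsto (fun q : ℝ × H => D.f q.1 q.2 - D.f q.1 x)
      (𝓝[Icc 0 D.T ×ˢ univ] (t, x)) (𝓝 0) := by
    refine squeeze_zero_norm' (a := fun q : ℝ × H => L * ‖q.2 - x‖) ?_ ?_
    · filter_upwards [self_mem_nhdsWithin,
        mem_nhdsWithin_of_mem_nhds (Metric.ball_mem_nhds (t, x) hε)] with q hq hqε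
      have hd := max_lt_iff.1 (Prod.dist_eq (x := q) (y := (t, x)) ▸ (Metric.mem_ball.1 hqε))
      exact hL q.1 hq.1 hd.1 q.2 hd.2 x (Metric.mem_ball_self hε)
    · have : Continuous fun q : ℝ × H => L * ‖q.2 - x‖ := by fun_prop
      simpa using (this.tendsto (t, x)).mono_left nhdsWithin_le_nhds
  simpa [ContinuousWithinAt] using h1.add h2

theorem continuous_f : Continuous fun q : ℝ × H => D.f (timeClamp D.T q.1) q.2 :=
  D.continuousOn_f.comp_continuous
    (((continuous_timeClamp D.T).comp continuous_fst).prodMk continuous_snd)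
    fun q => ⟨timeClamp_mem D.T_pos.le q.1, mem_univ _⟩

theorem continuousOn_f_along {y : ℝ → H} (hy : ContinuousOn y (Icc 0 D.T)) :
    ContinuousOn (fun t => D.f t (y t)) (Icc 0 D.T) :=
  D.continuousOn_f.comp (continuousOn_id.prodMk hy) fun _ ht => ⟨ht, mem_univ _⟩

theorem exists_regularAlong_f {y : ℝ → H} (hy : ContinuousOn y (Icc 0 D.T)) :
    ∃ δ L, RegularAlong (fun s => D.f (timeClamp D.T s)) (fun s => y (timeClamp D.T s)) δ L := by
  obtain ⟨δ, hδ, L, hL, h⟩ := exists_tube_lipschitz hy D.f_locallyLipschitz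
  exact ⟨δ, L, D.continuous_f, hy.comp_timeClamp D.T_pos.le, hδ, hL,
    fun s => h _ (timeClamp_mem D.T_pos.le s)⟩

theorem exists_regularAlong_l₁ {y : ℝ → H} (hy : ContinuousOn y (Icc 0 D.T)) :
    ∃ δ L, RegularAlong (fun _ => D.l₁) (fun s => y (timeClamp D.T s)) δ L := by
  obtain ⟨δ, hδ, L, hL, h⟩ := exists_tube_lipschitz (g := fun _ => D.l₁) hy fun t _ x => by
    obtain ⟨L, A, hA, hL⟩ := D.l₁_contDiff.locallyLipschitz x
    obtain ⟨ε, hε, hεA⟩ := Metric.mem_nhds_iff.1 hA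
    exact ⟨ε, hε, L, fun s _ _ z hz w hw => by
      simpa [dist_eq_norm] using hL.dist_le_mul z (hεA hz) w (hεA hw)⟩
  exact ⟨δ, L, D.l₁_contDiff.continuous.comp continuous_snd, hy.comp_timeClamp D.T_pos.le, hδ, hL,
    fun s => h _ (timeClamp_mem D.T_pos.le s)⟩

variable {D}

/-- Grönwall with zero initial term. The Lipschitz estimate along the two given curves holds on all
of `[0, T]`, so no continuation argument is needed. -/
theorem IsMildState.eqOn {u : ℝ → U} {y y' : ℝ → H} (hy : D.IsMildState u y)
    (hy' : D.IsMildState u y') {V : ℝ} (hV : ∀ s ∈ Icc 0 D.T, ‖u s‖ ≤ V) :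
    EqOn y' y (Icc 0 D.T) := by
  obtain ⟨M, hM⟩ := D.exists_norm_S_le
  have hM0 : 0 ≤ M := (norm_nonneg _).trans (hM 0)
  have hV0 : 0 ≤ V := (norm_nonneg _).trans (hV 0 (left_mem_Icc.2 D.T_pos.le))
  obtain ⟨L, hL, hLip⟩ := exists_lipschitz_along_curves hy.1 hy'.1 (D.continuousOn_f_along hy.1)
    (D.continuousOn_f_along hy'.1) D.f_locallyLipschitz
  have hn : ContinuousOn (fun t => ‖y t - y' t‖) (Icc 0 D.T) := (hy.1.sub hy'.1).norm
  have := gronwall_integral (a := 0) (k := M * (L * V)) hn le_rfl (by positivity) fun t ht => by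
    obtain ⟨hi, he⟩ := hy.2 t ht
    obtain ⟨hi', he'⟩ := hy'.2 t ht
    rw [he, he', add_sub_add_left_eq_sub, ← intervalIntegral.integral_sub hi hi', zero_add,
      ← intervalIntegral.integral_const_mul]
    refine intervalIntegral.norm_integral_le_of_norm_le ht.1
      (Eventually.of_forall fun s hs => ?_) ?_
    · have hs' : s ∈ Icc 0 D.T := ⟨hs.1.le, hs.2.trans ht.2⟩
      have hts : t - s ∈ Icc 0 D.T := ⟨by linarith [hs.2], by linarith [hs.1, ht.2]⟩
      have hMts := hM (t - s)
      rw [timeClamp_of_mem hts] at hMts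
      rw [← map_sub, ← sub_apply]
      calc _ ≤ M * ‖(D.f s (y s) - D.f s (y' s)) (u s)‖ :=
            ContinuousLinearMap.le_of_opNorm_le _ hMts _
        _ ≤ M * (L * ‖y s - y' s‖ * V) := by
            refine mul_le_mul_of_nonneg_left ?_ hM0
            exact (ContinuousLinearMap.le_opNorm _ _).trans
              (mul_le_mul (hLip s hs') (hV s hs') (norm_nonneg _) (by positivity))
        _ = M * (L * V) * ‖y s - y' s‖ := by ring
    · refine IntervalIntegrable.const_mul (ContinuousOn.intervalIntegrable ?_) _
      rw [uIcc_of_le ht.1]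
      exact hn.mono (Icc_subset_Icc_right ht.2)
  intro t ht
  have h0 := this t ht
  rw [zero_mul] at h0
  exact (sub_eq_zero.1 (norm_le_zero_iff.1 h0)).symm

theorem IsMildState.hasUniqueState {u : ℝ → U} {y : ℝ → H} (hy : D.IsMildState u y) {V : ℝ}
    (hV : ∀ s ∈ Icc 0 D.T, ‖u s‖ ≤ V) : D.HasUniqueState u :=
  ⟨y, hy, fun _ hy' => hy.eqOn hy' hV⟩

/-- By uniqueness, the arbitrary choice of state in `J₁` does not affect the cost. -/
theorem IsMildState.J₁_eq {u : ℝ → U} {y : ℝ → H} (hy : D.IsMildState u y) {V : ℝ}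
    (hV : ∀ s ∈ Icc 0 D.T, ‖u s‖ ≤ V) : D.J₁ u = D.trajectoryCost y := by
  have h : ∃ y, D.IsMildState u y := ⟨y, hy⟩
  have he := hy.eqOn h.choose_spec hV
  rw [J₁, dif_pos h, trajectoryCost, trajectoryCost, he (right_mem_Icc.2 D.T_pos.le),
    intervalIntegral_congr_of_Icc D.T_pos.le fun s hs => congrArg D.l₁ (he hs)]

/-- This returns from the clamped equation to the original one: on `[0, T]` the clamping is
invisible, and the forcing adds up with the reference right-hand side. -/
theorem IsMildState.add_perturbation {u : ℝ → U} {y : ℝ → H} (hy : D.IsMildState u y)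
    (hu : ContinuousOn u (Icc 0 D.T)) {r τ : ℝ} {v : U} {z : ℝ → H} (hz : Continuous z)
    {δ L B F : ℝ}
    (hf : RegularAlong (fun s => D.f (timeClamp D.T s)) (fun s => y (timeClamp D.T s)) δ L)
    (hF : ∀ s, ‖D.f (timeClamp D.T s) (y (timeClamp D.T s))‖ ≤ F)
    (hB : ∀ s, ‖u (timeClamp D.T s)‖ ≤ B) (hzδ : ∀ s, ‖z s‖ < δ)
    (hzeq : ∀ t ∈ Icc 0 D.T, z t = ∫ s in (0 : ℝ)..t, D.S (timeClamp D.T (t - s))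
      (needleForcing (fun s => D.f (timeClamp D.T s)) (fun s => y (timeClamp D.T s))
        (fun s => u (timeClamp D.T s)) r τ v s (z s))) :
    D.IsMildState (needle u r τ v) (fun s => y s + z s) := by
  obtain ⟨M, hM⟩ := D.exists_norm_S_le
  have hL := hf.nonneg
  have hB0 : 0 ≤ B := (norm_nonneg _).trans (hB 0)
  have hF0 : 0 ≤ F := (norm_nonneg _).trans (hF 0)
  refine ⟨hy.1.add hz.continuousOn, fun t ht => ?_⟩
  obtain ⟨hi, he⟩ := hy.2 t ht
  have hi2 := intervalIntegrable_kernel_apply D.continuous_S hM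
    (stronglyMeasurable_needleForcing hf (hu.comp_timeClamp D.T_pos.le) hz r τ v)
    (C := L * max B ‖v‖ * δ + F * (‖v‖ + B)) (fun s => by
      refine (norm_needleForcing_le hf hF hB r τ v s (hzδ s)).trans (add_le_add ?_ ?_)
      · exact mul_le_mul_of_nonneg_left (hzδ s).le (mul_nonneg hL (hB0.trans (le_max_left _ _)))
      · exact indicator_le_self' (fun _ _ => by positivity) s) t 0 t
  have hcongr : ∀ s ∈ Icc 0 t, D.S (t - s) (D.f s (y s) (u s)) + D.S (timeClamp D.T (t - s))
      (needleForcing (fun s => D.f (timeClamp D.T s)) (fun s => y (timeClamp D.T s))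
        (fun s => u (timeClamp D.T s)) r τ v s (z s)) =
      D.S (t - s) (D.f s (y s + z s) (needle u r τ v s)) := by
    intro s hs
    have hs' : s ∈ Icc 0 D.T := ⟨hs.1, hs.2.trans ht.2⟩
    have hts : t - s ∈ Icc 0 D.T := ⟨by linarith [hs.2], by linarith [hs.1, ht.2]⟩
    have hn : needle (fun s => u (timeClamp D.T s)) r τ v s = needle u r τ v s :=
      needle_congr (by rw [timeClamp_of_mem hs'])
    simp only [needleForcing, hn, timeClamp_of_mem hs', timeClamp_of_mem hts, map_sub]
    abel
  constructor
  · refine (hi.add hi2).congr fun s hs => hcongr s ?_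
    rw [uIoc_of_le ht.1] at hs
    exact Ioc_subset_Icc_self hs
  · rw [← intervalIntegral_congr_of_Icc ht.1 hcongr, intervalIntegral.integral_add hi hi2,
      ← hzeq t ht, ← add_assoc, ← he]

/-- The mode insertion gradient at `τ` in direction `v` is `P(τ) (v - u₁(τ))`. -/
theorem hasModeInsertionGradient {u₁ : ℝ → U} (hu₁ : ContinuousOn u₁ (Icc 0 D.T))
    {y : ℝ → H} (hy : D.IsMildState u₁ y) {p : ℝ → StrongDual ℝ H} (hp : D.IsMildAdjoint u₁ y p)
    {τ : ℝ} (hτ : τ ∈ Ioo 0 D.T) (v : U) :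
    D.HasModeInsertionGradient u₁ τ v (D.P y p τ (v - u₁ τ)) := by
  have hT := D.T_pos.le
  obtain ⟨M, hM⟩ := D.exists_norm_S_le
  obtain ⟨δ, L, hf⟩ := D.exists_regularAlong_f hy.1
  obtain ⟨δ', L', hl⟩ := D.exists_regularAlong_l₁ hy.1
  obtain ⟨F, hF⟩ := (D.continuousOn_f_along hy.1).exists_bound_timeClamp hT
  obtain ⟨B, hB⟩ := hu₁.exists_bound_timeClamp hT
  obtain ⟨A, hA⟩ := hp.1.exists_bound_timeClamp hT
  have hu := hu₁.comp_timeClamp hT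
  have hBI : ∀ s ∈ Icc 0 D.T, ‖u₁ s‖ ≤ B := fun s hs => by
    have := hB s
    rwa [timeClamp_of_mem hs] at this
  have hVI : ∀ r, ∀ s ∈ Icc 0 D.T, ‖needle u₁ r τ v s‖ ≤ max B ‖v‖ := fun r s hs => by
    rw [needle_congr (u' := fun s => u₁ (timeClamp D.T s)) (by rw [timeClamp_of_mem hs])]
    exact norm_needle_le hB s
  obtain ⟨C, z, hz⟩ := exists_needle_perturbation D.continuous_S hM hT hf hF hu hB τ v
  have hstate : ∀ᶠ r in 𝓝[>] (0 : ℝ), D.IsMildState (needle u₁ r τ v) fun s => y s + z r s := by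
    filter_upwards [hz, eventually_const_mul_lt (C := C) hf.pos] with r hr hrδ
    exact hy.add_perturbation hu₁ hr.1 hf hF hB (fun s => (hr.2.1 s).trans_lt hrδ) hr.2.2
  refine ⟨hy.hasUniqueState hBI, hstate.mono fun r hr => hr.hasUniqueState (hVI r), ?_⟩
  -- The adjoint equation involves only times in `[0, T]`, where the clamped data agree with the
  -- given data.
  have hsrc : ∀ t ∈ Icc 0 D.T, ∀ s ∈ Icc t D.T,
      ((p s).comp (fderiv ℝ (fun z => D.f s z (u₁ s)) (y s)) + fderiv ℝ D.l₁ (y s)).comp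
        (D.S (s - t)) = (adjointSource (fun s => D.f (timeClamp D.T s))
          (fun s => y (timeClamp D.T s)) (fun s => u₁ (timeClamp D.T s)) D.l₁
          (fun s => p (timeClamp D.T s)) s).comp (D.S (timeClamp D.T (s - t))) := by
    intro t ht s hs
    have hs' : s ∈ Icc 0 D.T := ⟨ht.1.trans hs.1, hs.2⟩
    have hst : s - t ∈ Icc 0 D.T := ⟨by linarith [hs.1], by linarith [hs.2, ht.1]⟩
    simp only [adjointSource, timeClamp_of_mem hs', timeClamp_of_mem hst]
  have hTT : timeClamp D.T D.T = D.T := timeClamp_of_mem (right_mem_Icc.2 hT)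
  have key := tendsto_needle_cost (m := D.m) D.continuous_S hM hf hF
    (fun s => ((D.f_contDiff _ (timeClamp_mem hT s)).differentiable one_ne_zero) _) hu hB hl
    (D.l₁_contDiff.differentiable one_ne_zero)
    ((D.m_contDiff.differentiable one_ne_zero) _) (hp.1.comp_timeClamp hT) hA
    (fun t ht => by
      obtain ⟨hi, he⟩ := hp.2 t ht
      constructor
      · refine hi.congr fun s hs => hsrc t ht s ?_
        rw [uIoc_of_le ht.2] at hs
        exact Ioc_subset_Icc_self hs
      · have htT : D.T - t ∈ Icc 0 D.T := ⟨by linarith [ht.2], by linarith [ht.1]⟩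
        simp only [timeClamp_of_mem ht, timeClamp_of_mem htT, hTT]
        rw [← intervalIntegral_congr_of_Icc ht.2 (hsrc t ht)]
        exact he) hτ hz
  simp only [timeClamp_of_mem (Ioo_subset_Icc_self hτ), hTT] at key
  refine key.congr' ?_
  filter_upwards [hstate] with r hr
  rw [hr.J₁_eq (hVI r), hy.J₁_eq hBI, trajectoryCost, trajectoryCost, div_eq_inv_mul,
    intervalIntegral_congr_of_Icc hT (g := fun s => D.l₁ (y (timeClamp D.T s) + z r s))
      (h := fun s => D.l₁ (y s + z r s)) fun s hs => by rw [timeClamp_of_mem hs],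
    intervalIntegral_congr_of_Icc hT (g := fun s => D.l₁ (y (timeClamp D.T s)))
      (h := fun s => D.l₁ (y s)) fun s hs => by rw [timeClamp_of_mem hs]]

/-- Since the gradient is `P (v - u₁)`, the subproblem is least squares in `v` with shifted target
`P u₁ + α`. -/
theorem sacDescent_of_norm_lt {u₁ : ℝ → U} (hu₁ : ContinuousOn u₁ (Icc 0 D.T))
    {y : ℝ → H} (hy : D.IsMildState u₁ y) {p : ℝ → StrongDual ℝ H} (hp : D.IsMildAdjoint u₁ y p)
    {γ : ℝ} (hγ : 0 < γ) (hR : ∀ u : U, γ * ‖u‖ ^ 2 ≤ inner ℝ (D.R u) u) {τ : ℝ}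
    (hτ : τ ∈ Ioo 0 D.T) (hP : D.P y p τ ≠ 0) {α : ℝ} (hα : α < 0)
    (hbig : ‖D.R‖ ^ 2 * ‖u₁ τ‖ < γ * ‖D.P y p τ‖ * (-α)) : D.SACDescent u₁ y p α τ := by
  have hG := fun v => hasModeInsertionGradient hu₁ hy hp hτ v
  have hw := regularized_normal_equation (P := D.P y p τ) (a := D.P y p τ (u₁ τ) + α)
    (w := D.sacControl u₁ y p α τ) D.R_selfAdjoint hγ hR (by rw [sacControl, Pi, ← map_add])
  have hmin := forall_le_regularized_iff D.R_selfAdjoint hγ hR hw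
  have hshift : ∀ v, D.P y p τ (v - u₁ τ) - α = D.P y p τ v - (D.P y p τ (u₁ τ) + α) := fun v => by
    rw [map_sub]; ring
  refine ⟨fun v => ⟨?_, fun hv => ⟨_, hG, ?_⟩⟩, _, ?_, hG _⟩
  · rintro ⟨G, hGv, hv⟩
    -- `IsSACControl` only asserts that some gradients `G` exist; uniqueness of limits identifies
    -- them.
    have hGe : ∀ w, G w = D.P y p τ (w - u₁ τ) := fun w =>
      tendsto_nhds_unique (hGv w).2.2 (hG w).2.2
    refine (hmin v).1 fun x => ?_
    simpa only [hGe, hshift] using hv x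
  · simpa only [hshift] using (hmin v).2 hv
  · exact regularized_descent hγ hR hα hP hw hbig

theorem continuousOn_P {y : ℝ → H} (hy : ContinuousOn y (Icc 0 D.T)) {p : ℝ → StrongDual ℝ H}
    (hp : ContinuousOn p (Icc 0 D.T)) : ContinuousOn (D.P y p) (Icc 0 D.T) :=
  hp.clm_comp (D.continuousOn_f_along hy)

end StageProblem

theorem proposition2p2 {H U : Type*}
    [NormedAddCommGroup H] [InnerProductSpace ℝ H] [CompleteSpace H]
    [NormedAddCommGroup U] [InnerProductSpace ℝ U] [CompleteSpace U]
    (D : StageProblem H U) (u₁ : ℝ → U) (hu₁ : ContinuousOn u₁ (Icc 0 D.T))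
    (y : ℝ → H) (hy : D.IsMildState u₁ y)
    (p : ℝ → StrongDual ℝ H) (hp : D.IsMildAdjoint u₁ y p) :
    -- one parameter for all times, if `P` does not vanish on `[0, T]`
    ((∀ t ∈ Icc 0 D.T, D.P y p t ≠ 0) →
      ∃ α < 0, ∀ τ ∈ Ioo 0 D.T, D.SACDescent u₁ y p α τ) ∧
    -- for zero reference control it suffices that `P` does not vanish on `(0, T)`
    ((∀ t ∈ Icc 0 D.T, u₁ t = 0) → (∀ t ∈ Ioo 0 D.T, D.P y p t ≠ 0) →
      ∃ α < 0, ∀ τ ∈ Ioo 0 D.T, D.SACDescent u₁ y p α τ) ∧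
    -- at a single time it suffices that `P` does not vanish there
    (∀ τ ∈ Ioo 0 D.T, D.P y p τ ≠ 0 → ∃ α < 0, D.SACDescent u₁ y p α τ) := by
  obtain ⟨γ, hγ, hR⟩ := D.R_coercive
  -- One `α` serves all times at which `‖P‖ ≥ ε` and `‖u₁‖ ≤ b`. The quotient in its definition
  -- balances the descent condition, and the added 1 makes the inequality strict.
  have hchoice : ∀ {ε b : ℝ}, 0 < ε → 0 ≤ b → ∃ α < 0, ∀ τ ∈ Ioo 0 D.T, ε ≤ ‖D.P y p τ‖ →
      ‖u₁ τ‖ ≤ b → D.SACDescent u₁ y p α τ := by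
    intro ε b hε hb
    refine ⟨-(‖D.R‖ ^ 2 * b / (γ * ε) + 1), neg_lt_zero.2 (by positivity),
      fun τ hτ hετ hbτ => ?_⟩
    refine StageProblem.sacDescent_of_norm_lt hu₁ hy hp hγ hR hτ (norm_pos_iff.1 (hε.trans_le hετ))
      (neg_lt_zero.2 (by positivity)) ?_
    rw [neg_neg]
    calc ‖D.R‖ ^ 2 * ‖u₁ τ‖ ≤ ‖D.R‖ ^ 2 * b := by gcongr
      _ < ‖D.R‖ ^ 2 * b + γ * ε := lt_add_of_pos_right _ (mul_pos hγ hε)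
      _ = γ * ε * (‖D.R‖ ^ 2 * b / (γ * ε) + 1) := by field_simp
      _ ≤ _ := by gcongr
  -- For `u₁ = 0` the left side of the descent condition vanishes, so `-1` works as any negative
  -- number would, even if `P` degenerates at the endpoints.
  refine ⟨fun hP => ?_, fun hu0 hP => ⟨-1, by norm_num, fun τ hτ => ?_⟩, fun τ hτ hP => ?_⟩
  · obtain ⟨t₀, ht₀, hmin⟩ := isCompact_Icc.exists_isMinOn (nonempty_Icc.2 D.T_pos.le)
      (StageProblem.continuousOn_P hy.1 hp.1).norm
    obtain ⟨b, hb⟩ := isCompact_Icc.exists_bound_of_continuousOn hu₁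
    obtain ⟨α, hα, h⟩ := hchoice (norm_pos_iff.2 (hP t₀ ht₀)) ((norm_nonneg _).trans (hb t₀ ht₀))
    exact ⟨α, hα, fun τ hτ => h τ hτ (hmin (Ioo_subset_Icc_self hτ))
      (hb τ (Ioo_subset_Icc_self hτ))⟩
  · refine StageProblem.sacDescent_of_norm_lt hu₁ hy hp hγ hR hτ (hP τ hτ) (by norm_num) ?_
    rw [hu0 τ (Ioo_subset_Icc_self hτ), norm_zero, mul_zero]
    have := norm_pos_iff.2 (hP τ hτ)
    positivity
  · obtain ⟨α, hα, h⟩ := hchoice (norm_pos_iff.2 hP) (norm_nonneg (u₁ τ))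
    exact ⟨α, hα, h τ hτ le_rfl le_rfl⟩
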